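/- Let $\mathbb T^N=(\mathbb R/\mathbb Z)^N$ with its Lebesgue measure and let $1\le p<1+\frac2N$, where either $N\ge 2$, or $N=1$ and $p\le 2$. For $t\ge 0$ let $e^{t\Delta}$ be the heat semigroup on $\mathbb T^N$, $\widehat{e^{t\Delta}f}(\mathbf k)=e^{-4\pi^2t|\mathbf k|^2}\hat f(\mathbf k)$, $\mathbf k\in\mathbb Z^N$. Consider the equation $$u_t+v\cdot\nabla u-\Delta u=|u|^p-\int_{\mathbb T^N}|u|^p\,dx\quad\text{on }\mathbb T^N,\qquad u(0)=u_0,$$ with $u_0\in L^2(\mathbb T^N)$ real-valued and $v$ a measurable vector field in $L^\infty\big(\mathbb R_+;L^{\frac{2}{p-1}}(\mathbb T^N;\mathbb R^N)\big)$ (with $\frac{2}{p-1}=\infty$ if $p=1$). A function $u\in C([0,T];L^2(\mathbb T^N))$ with $\nabla u(t)\in L^2(\mathbb T^N)$ for every $0<t\le T$ is called a mild solution on $[0,T]$ if for all $t\in[0,T]$ $$u(t)=e^{t\Delta}u_0+\int_0^te^{(t-\tau)\Delta}\big(|u(\tau)|^p\big)\,d\tau-\int_0^te^{(t-\tau)\Delta}\big(v(\tau)\cdot\nabla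 u(\tau)\big)\,d\tau-\int_0^t\int_{\mathbb T^N}|u(\tau)|^p\,dx\,d\tau,$$ where the integrals exist as Bochner integrals (the first two in $L^2(\mathbb T^N)$). Let $X_T$ be the set of $u\in C([0,T];L^2(\mathbb T^N))$ with $\nabla u(t)\in L^2(\mathbb T^N)$ for $0<t\le T$ and $\sup_{0<t\le T}t^{1/2}\|\nabla u(t)\|_{L^2}<\infty$. **Theorem.** For all $A,B\ge 0$ there is $T\in(0,1]$, depending only on $N$, $p$, $A$ and $B$, such that for every $u_0$ with $\|u_0\|_{L^2}\le B$ and every $v$ with $\operatorname{ess\,sup}_{t>0}\|v(t)\|_{L^{2/(p-1)}}\le A$, the equation has a mild solution $u\in X_T$ on $[0,T]$, and $u$ is the only mild solution on $[0,T]$ that belongs to $X_T$. -/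

import Mathlib

open MeasureTheory Set
open scoped ENNReal NNReal

noncomputable section

namespace NonlocalHeat

/-- The torus `𝕋ᴺ = (ℝ/ℤ)ᴺ`; its `volume` is the probability Haar (Lebesgue) measure. -/
abbrev Torus (N : ℕ) : Type := UnitAddTorus (Fin N)

/-- Real-valued `L²(𝕋ᴺ)`. -/
abbrev L2 (N : ℕ) : Type := Lp ℝ 2 (volume : Measure (Torus N))

/-- Vector-valued `L²(𝕋ᴺ; ℝᴺ)`. -/
abbrev L2Vec (N : ℕ) : Type :=
  Lp (EuclideanSpace ℝ (Fin N)) 2 (volume : Measure (Torus N))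

/-- The Fourier coefficient `f̂(k) = ∫ f(x) e^{-2π i k·x} dx` of a real function on the torus. -/
def coeff {N : ℕ} (f : Torus N → ℝ) (k : Fin N → ℤ) : ℂ :=
  ∫ x, UnitAddTorus.mFourier (-k) x * (f x : ℂ)

/-- `g = e^{tΔ} f`, that is, `ĝ(k) = e^{-4π² t |k|²} f̂(k)` for all `k`. -/
def IsHeat {N : ℕ} (t : ℝ) (f : Torus N → ℝ) (g : L2 N) : Prop :=
  ∀ k : Fin N → ℤ,
    coeff g k = (Real.exp (-(4 * Real.pi ^ 2 * t * ∑ j, (k j : ℝ) ^ 2)) : ℂ) * coeff f k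

open Classical in
/-- The heat semigroup `e^{tΔ} f` as an element of `L²(𝕋ᴺ)`. Such an element is unique, and it
exists if `t > 0` and `f ∈ L¹`, or if `t = 0` and `f ∈ L²`; if there is none, the value is `0` by
convention. -/
def heat {N : ℕ} (t : ℝ) (f : Torus N → ℝ) : L2 N :=
  if h : ∃ g : L2 N, IsHeat t f g then h.choose else 0

/-- `g` is the (weak) gradient of `f`: `ĝ_j(k) = 2π i k_j f̂(k)` for all `j` and `k`. -/
def IsGrad {N : ℕ} (f : L2 N) (g : L2Vec N) : Prop :=
  ∀ (j : Fin N) (k : Fin N → ℤ),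
    coeff (fun x => g x j) k = 2 * (Real.pi : ℂ) * Complex.I * (k j : ℂ) * coeff f k

/-- `∇f ∈ L²(𝕋ᴺ)`. -/
def HasGrad {N : ℕ} (f : L2 N) : Prop := ∃ g : L2Vec N, IsGrad f g

open Classical in
/-- The gradient `∇f ∈ L²(𝕋ᴺ; ℝᴺ)` (the zero field if there is none). -/
def grad {N : ℕ} (f : L2 N) : L2Vec N := if h : HasGrad f then h.choose else 0

/-- The norm of `L^∞(ℝ₊; L^q(𝕋ᴺ; ℝᴺ))`, with values in `[0, ∞]`. -/
def normLinfLq {N : ℕ} (q : ℝ≥0∞) (v : ℝ → Torus N → EuclideanSpace ℝ (Fin N)) : ℝ≥0∞ :=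
  essSup (fun t => eLpNorm (v t) q volume) (volume.restrict (Ioi (0 : ℝ)))

/-- Membership in `L^∞(ℝ₊; L^q(𝕋ᴺ; ℝᴺ))`. -/
def MemLinfLq {N : ℕ} (q : ℝ≥0∞) (v : ℝ → Torus N → EuclideanSpace ℝ (Fin N)) : Prop :=
  AEStronglyMeasurable (Function.uncurry v)
      ((volume.restrict (Ioi (0 : ℝ))).prod (volume : Measure (Torus N))) ∧
    normLinfLq q v < ∞

/-- `u ∈ X_T`: `u ∈ C([0,T]; L²)`, `∇u(t) ∈ L²` for `0 < t ≤ T` and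
`sup_{0 < t ≤ T} t^{1/2} ‖∇u(t)‖_{L²} < ∞`. Only the values of `u` on `[0,T]` matter. -/
def MemX {N : ℕ} (T : ℝ) (u : ℝ → L2 N) : Prop :=
  ContinuousOn u (Icc 0 T) ∧ (∀ t ∈ Ioc 0 T, HasGrad (u t)) ∧
    BddAbove ((fun t => Real.sqrt t * ‖grad (u t)‖) '' Ioc 0 T)

/-- The function `|u|^p`. -/
def powAbs {N : ℕ} (p : ℝ) (u : L2 N) : Torus N → ℝ := fun x => |u x| ^ p

/-- The function `w · ∇u`. -/
def advect {N : ℕ} (w : Torus N → EuclideanSpace ℝ (Fin N)) (u : L2 N) : Torus N → ℝ :=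
  fun x => inner ℝ (w x) (grad u x)

/-- `u` is a mild solution on `[0,T]` of `u_t + v·∇u - Δu = |u|^p - ∫ |u|^p`, `u(0) = u₀`. The
integrals over `[0,t]` are Bochner integrals, the first two in `L²(𝕋ᴺ)`, and are required to
exist; the last one is a number, regarded as a constant function. -/
structure IsMildSolution {N : ℕ} (p : ℝ) (v : ℝ → Torus N → EuclideanSpace ℝ (Fin N))
    (u₀ : L2 N) (T : ℝ) (u : ℝ → L2 N) : Prop where
  continuousOn : ContinuousOn u (Icc 0 T)
  hasGrad : ∀ t ∈ Ioc 0 T, HasGrad (u t)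
  integrable_source : ∀ t ∈ Icc 0 T,
    IntervalIntegrable (fun τ => heat (t - τ) (powAbs p (u τ))) volume 0 t
  integrable_advection : ∀ t ∈ Icc 0 T,
    IntervalIntegrable (fun τ => heat (t - τ) (advect (v τ) (u τ))) volume 0 t
  integrable_mean : ∀ t ∈ Icc 0 T,
    IntervalIntegrable (fun τ => ∫ x, powAbs p (u τ) x) volume 0 t
  eq : ∀ t ∈ Icc 0 T,
    u t = heat t u₀ + (∫ τ in (0 : ℝ)..t, heat (t - τ) (powAbs p (u τ)))
      - (∫ τ in (0 : ℝ)..t, heat (t - τ) (advect (v τ) (u τ)))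
      - Lp.const 2 volume (∫ τ in (0 : ℝ)..t, ∫ x, powAbs p (u τ) x)

end NonlocalHeat

end

open MeasureTheory Set Filter Topology

noncomputable section

namespace NonlocalHeat

/-! ### Fourier series and weak gradients in L² of the torus. -/

section

variable {N : ℕ}

/-! Both local nonlinear terms live in L^{2/p}: |u|^p because u is in L², and v·∇u by Hölder, since
(p-1)/2 + 1/2 = p/2 (`powAbs_sub_bddLr`, `inner_bddLr`); here p ≤ 2 makes 2/p ≥ 1. For t ≤ 1 the
heat semigroup maps L^{2/p} to L² with norm O(t^{-N(p-1)/4}) (`norm_heat_le`), and a gradient costs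
another t^{-1/2} (`hasGrad_heat`). On a ball of X_T the source is O(τ^{-1/2}) in L^{2/p}, so the
Duhamel integral, and √t times its gradient, are controlled by the integral of (t-τ)^{-b} + τ^{-b}
with b = N(p-1)/4 + 1/2. The condition p < 1 + 2/N says exactly that b < 1, and the integral over
(s,t) is then O((t-s)^{1-b}) with a constant independent of s (`integral_ker_le`).

Hence the Duhamel map has Lipschitz constant `mapC` · T^{1-b} on a ball
(`Ball.norm_duhamelMap_sub_le`). The heat flow of u₀ is bounded by B in both parts of the norm, so
once this constant is at most 1/2 the Picard iterates from 0 stay in the ball of radius 2B and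
converge (`exists_fixedPoint`). A competing solution lies in a ball of uncontrolled radius R, for
which T need not be small. But the estimate also holds on (s,t) for solutions agreeing up to s, so
equality propagates through windows of a length δ that depends on R but not on s
(`Ball.eqOn_of_fixedPoint`).

The heat flow and the gradient are Fourier multipliers: their L² bounds are Parseval, the L^{2/p}
bound is an interpolation, and measurability in time is checked coefficient by coefficient
(`aestronglyMeasurable_of_coeff`). -/

lemma volume_circle : (volume : Measure UnitAddCircle) = AddCircle.haarAddCircle := by
  rw [AddCircle.volume_eq_smul_haarAddCircle, ENNReal.ofReal_one, one_smul]

instance : IsProbabilityMeasure (volume : Measure UnitAddCircle) := by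
  rw [volume_circle]; infer_instance

lemma volume_torus : (volume : Measure (Torus N)) =
    Measure.pi fun _ : Fin N => (AddCircle.haarAddCircle : Measure UnitAddCircle) := by
  rw [← volume_circle]; rfl

instance : IsProbabilityMeasure (volume : Measure (Torus N)) :=
  inferInstanceAs (IsProbabilityMeasure (Measure.pi fun _ : Fin N => (volume : Measure UnitAddCircle)))

/-- The measure is a variable so that `subst` can carry the basis, built for the product Haar
measure, over to `volume`. -/
lemma exists_fourier_basis (μ : Measure (Torus N))
    (hμ : μ = Measure.pi fun _ : Fin N => (AddCircle.haarAddCircle : Measure UnitAddCircle)) :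
    ∃ b : HilbertBasis (Fin N → ℤ) ℂ (Lp ℂ 2 μ), ∀ (f : Lp ℂ 2 μ) (k : Fin N → ℤ),
      b.repr f k = ∫ x, UnitAddTorus.mFourier (-k) x * f x ∂μ := by
  subst hμ
  exact ⟨UnitAddTorus.mFourierBasis, UnitAddTorus.mFourierBasis_repr⟩

/-- The orthonormal basis of exponentials. -/
def fourierBasis : HilbertBasis (Fin N → ℤ) ℂ (Lp ℂ 2 (volume : Measure (Torus N))) :=
  (exists_fourier_basis volume volume_torus).choose

lemma fourierBasis_repr (f : Lp ℂ 2 (volume : Measure (Torus N))) (k : Fin N → ℤ) :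
    fourierBasis.repr f k = ∫ x, UnitAddTorus.mFourier (-k) x * f x :=
  (exists_fourier_basis volume volume_torus).choose_spec f k

lemma integral_mFourier {k : Fin N → ℤ} (hk : k ≠ 0) :
    ∫ x : Torus N, UnitAddTorus.mFourier k x = 0 := by
  have key : ∀ μ : Measure (Torus N), 
    (μ = Measure.pi fun _ : Fin N => (AddCircle.haarAddCircle : Measure UnitAddCircle)) → 
      ∫ x : Torus N, UnitAddTorus.mFourier k x ∂μ = 0 := by
    rintro μ rfl
    have h2 := orthonormal_iff_ite.1 (UnitAddTorus.orthonormal_mFourier (d := Fin N)) 0 k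
    rw [if_neg hk.symm, ContinuousMap.inner_toLp] at h2
    simp only [UnitAddTorus.mFourier_zero, ContinuousMap.one_apply, map_one, mul_one] at h2
    exact h2
  exact key _ volume_torus


/-- The eigenvalue `4π²|k|²` of `-Δ` on the torus. -/
def lam (k : Fin N → ℤ) : ℝ := 4 * Real.pi ^ 2 * ∑ j, (k j : ℝ) ^ 2

lemma lam_nonneg (k : Fin N → ℤ) : 0 ≤ lam k := by unfold lam; positivity

lemma lam_neg (k : Fin N → ℤ) : lam (-k) = lam k := by simp [lam]

/-- Complexification of a real `L²` function. -/
def toC : L2 N →L[ℝ] Lp ℂ 2 (volume : Measure (Torus N)) :=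
  Complex.ofRealCLM.compLpL 2 volume

/-- Real part of a complex `L²` function. -/
def reL : Lp ℂ 2 (volume : Measure (Torus N)) →L[ℝ] L2 N :=
  Complex.reCLM.compLpL 2 volume

lemma toC_coe (f : L2 N) : toC f =ᵐ[volume] fun x => (f x : ℂ) :=
  Complex.ofRealCLM.coeFn_compLpL f

lemma reL_coe (f : Lp ℂ 2 (volume : Measure (Torus N))) : reL f =ᵐ[volume] fun x => (f x).re :=
  Complex.reCLM.coeFn_compLpL f

lemma reL_toC (f : L2 N) : reL (toC f) = f := by
  apply Lp.ext
  filter_upwards [reL_coe (toC f), toC_coe f] with x h1 h2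
  rw [h1, h2, Complex.ofReal_re]

lemma norm_toC (f : L2 N) : ‖toC f‖ = ‖f‖ := by
  refine le_antisymm (Lp.norm_le_norm_of_ae_le ?_) (Lp.norm_le_norm_of_ae_le ?_) <;>
  · filter_upwards [toC_coe f] with x h
    rw [h, Complex.norm_real]

lemma coeff_eq_repr (f : L2 N) (k : Fin N → ℤ) : coeff f k = fourierBasis.repr (toC f) k := by
  rw [fourierBasis_repr]
  unfold coeff
  apply integral_congr_ae
  filter_upwards [toC_coe f] with x h
  rw [h]

/-- The Fourier coefficient as a continuous linear functional. -/
def coeffL (k : Fin N → ℤ) : L2 N →L[ℝ] ℂ :=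
  ((innerSL ℂ (fourierBasis k)).restrictScalars ℝ).comp toC

lemma coeffL_apply (f : L2 N) (k : Fin N → ℤ) : coeffL k f = coeff f k := by
  rw [coeff_eq_repr, HilbertBasis.repr_apply_apply]
  rfl

lemma hasSum_coeff_sq (f : L2 N) : HasSum (fun k => ‖coeff f k‖ ^ 2) (‖f‖ ^ 2) := by
  rw [← norm_toC, ← fourierBasis.repr.norm_map]
  have h := lp.hasSum_norm (p := 2) (by norm_num) (fourierBasis.repr (toC f))
  simpa [← coeff_eq_repr] using h

lemma coeff_conj (f : Torus N → ℝ) (k : Fin N → ℤ) :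
    coeff f (-k) = (starRingEnd ℂ) (coeff f k) := by
  unfold coeff
  rw [← integral_conj]
  congr 1
  ext x
  rw [map_mul, ← UnitAddTorus.mFourier_neg, Complex.conj_ofReal]

lemma eq_of_coeff_eq {f g : L2 N} (h : ∀ k : Fin N → ℤ, coeff f k = coeff g k) : f = g := by
  rw [← sub_eq_zero, ← norm_eq_zero, ← sq_eq_zero_iff]
  refine (hasSum_coeff_sq (f - g)).unique ?_
  convert! hasSum_zero with k
  rw [← coeffL_apply, map_sub, coeffL_apply, coeffL_apply, h, sub_self, norm_zero]
  simp

/-- Riesz–Fischer gives a complex G with coefficients c. The k-th coefficient of its real part is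
the mean of c k and the conjugate of c (-k), which the symmetry of c makes equal to c k. -/
lemma exists_of_coeff {c : (Fin N → ℤ) → ℂ} (hc : Summable fun k => ‖c k‖ ^ 2)
    (hconj : ∀ k, c (-k) = (starRingEnd ℂ) (c k)) : ∃ g : L2 N, ∀ k, coeff g k = c k := by
  have hm : Memℓp c 2 := by
    apply memℓp_gen
    simpa using hc
  let G := (fourierBasis (N := N)).repr.symm ⟨c, hm⟩
  have hG : ∀ k, ∫ x, UnitAddTorus.mFourier (-k) x * G x = c k := fun k => by
    rw [← fourierBasis_repr]
    simp [G]
  refine ⟨reL G, fun k => ?_⟩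
  have hGi : ∀ k : Fin N → ℤ, Integrable (fun x => UnitAddTorus.mFourier k x * G x) volume := by
    intro k
    refine Integrable.bdd_mul (c := 1) ((Lp.memLp G).integrable (by norm_num)) ?_ ?_
    · exact (UnitAddTorus.mFourier k).continuous.aestronglyMeasurable
    · exact .of_forall fun x => (UnitAddTorus.mFourier k).norm_coe_le_norm x |>.trans
        UnitAddTorus.mFourier_norm.le
  have h1 : coeff (reL G) k = ∫ x, ((UnitAddTorus.mFourier (-k) x * G x) / 2
      + (starRingEnd ℂ) (UnitAddTorus.mFourier k x * G x) / 2) := by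
    unfold coeff
    apply integral_congr_ae
    filter_upwards [reL_coe G] with x hx
    rw [hx, map_mul, ← UnitAddTorus.mFourier_neg, Complex.re_eq_add_conj]
    ring
  have h2 := hG k
  have h3 := hG (-k)
  rw [neg_neg] at h3
  rw [h1, integral_add ((hGi _).div_const _), integral_div, integral_div, integral_conj, h2, h3,
    hconj]
  · simp
  · refine Integrable.div_const ?_ _
    exact (Complex.conjCLE.toContinuousLinearMap.integrable_comp (hGi k))

lemma norm_sq_eq_tsum (f : L2 N) : ‖f‖ ^ 2 = ∑' k, ‖coeff f k‖ ^ 2 :=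
  (hasSum_coeff_sq f).tsum_eq.symm

/-- The `j`-th component of a square integrable vector field. -/
def comp (j : Fin N) : L2Vec N →L[ℝ] L2 N :=
  (EuclideanSpace.proj (𝕜 := ℝ) j).compLpL 2 volume

lemma comp_coe (j : Fin N) (g : L2Vec N) : comp j g =ᵐ[volume] fun x => g x j :=
  (EuclideanSpace.proj (𝕜 := ℝ) j).coeFn_compLpL g

/-- The vector field `f e_j`. -/
def emb (j : Fin N) : L2 N →L[ℝ] L2Vec N :=
  (ContinuousLinearMap.toSpanSingleton ℝ (EuclideanSpace.single j (1 : ℝ))).compLpL 2 volume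

lemma emb_coe (j : Fin N) (f : L2 N) :
    emb j f =ᵐ[volume] fun x => f x • EuclideanSpace.single j (1 : ℝ) :=
  (ContinuousLinearMap.toSpanSingleton ℝ (EuclideanSpace.single j (1 : ℝ))).coeFn_compLpL f

lemma comp_emb (i j : Fin N) (f : L2 N) : comp i (emb j f) = if i = j then f else 0 := by
  apply Lp.ext
  split_ifs with h
  · filter_upwards [comp_coe i (emb j f), emb_coe j f] with x h1 h2
    rw [h1, h2]; simp [h]
  · filter_upwards [comp_coe i (emb j f), emb_coe j f,
      Lp.coeFn_zero ℝ 2 (volume : Measure (Torus N))] with x h1 h2 h3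
    rw [h1, h2, h3]; simp [h]

lemma comp_ext {g h : L2Vec N} (H : ∀ j, comp j g = comp j h) : g = h := by
  apply Lp.ext
  have h1 : ∀ᵐ x, ∀ j, comp j g x = g x j := ae_all_iff.2 fun j => comp_coe j g
  have h2 : ∀ᵐ x, ∀ j, comp j h x = h x j := ae_all_iff.2 fun j => comp_coe j h
  filter_upwards [h1, h2] with x h1 h2
  ext j
  rw [← h1, ← h2, H]

lemma sum_emb_comp (g : L2Vec N) : ∑ j, emb j (comp j g) = g := by
  apply comp_ext
  intro i
  rw [map_sum]
  simp [comp_emb]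

lemma norm_sq_vec (g : L2Vec N) : ‖g‖ ^ 2 = ∑ j, ‖comp j g‖ ^ 2 := by
  rw [← real_inner_self_eq_norm_sq, L2.inner_def]
  simp_rw [← real_inner_self_eq_norm_sq, L2.inner_def]
  rw [← integral_finsetSum _ fun j _ => L2.integrable_inner _ _]
  apply integral_congr_ae
  have h1 : ∀ᵐ x, ∀ j, comp j g x = g x j := ae_all_iff.2 fun j => comp_coe j g
  filter_upwards [h1] with x h1
  simp_rw [h1]
  rw [PiLp.inner_apply]

lemma coeff_congr {f g : Torus N → ℝ} (h : f =ᵐ[volume] g) (k : Fin N → ℤ) :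
    coeff f k = coeff g k := by
  unfold coeff
  apply integral_congr_ae
  filter_upwards [h] with x h
  rw [h]

lemma coeff_comp (g : L2Vec N) (j : Fin N) (k : Fin N → ℤ) :
    coeff (comp j g) k = coeff (fun x => g x j) k := coeff_congr (comp_coe j g) k

lemma isGrad_iff {f : L2 N} {g : L2Vec N} : IsGrad f g ↔ ∀ (j : Fin N) (k : Fin N → ℤ),
    coeff (comp j g) k = 2 * (Real.pi : ℂ) * Complex.I * (k j : ℂ) * coeff f k := by
  simp_rw [coeff_comp]; rfl

/-- Fourier coefficients determine each component, so the choice made in `grad` is immaterial. -/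
lemma IsGrad.unique {f : L2 N} {g h : L2Vec N} (hg : IsGrad f g) (hh : IsGrad f h) : g = h := by
  rw [isGrad_iff] at hg hh
  exact comp_ext fun j => eq_of_coeff_eq fun k => by rw [hg, hh]

lemma HasGrad.isGrad {f : L2 N} (h : HasGrad f) : IsGrad f (grad f) := by
  unfold grad; rw [dif_pos h]; exact h.choose_spec

lemma IsGrad.hasGrad {f : L2 N} {g : L2Vec N} (hg : IsGrad f g) : HasGrad f := ⟨g, hg⟩

lemma IsGrad.grad_eq {f : L2 N} {g : L2Vec N} (hg : IsGrad f g) : grad f = g :=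
  hg.hasGrad.isGrad.unique hg

/-- Parseval in each component; summing over j turns the symbols 2πi k_j into `lam k`. -/
lemma IsGrad.hasSum {f : L2 N} {g : L2Vec N} (hg : IsGrad f g) :
    HasSum (fun k => lam k * ‖coeff f k‖ ^ 2) (‖g‖ ^ 2) := by
  rw [norm_sq_vec]
  have h := hasSum_sum fun (j : Fin N) (_ : j ∈ Finset.univ) => hasSum_coeff_sq (comp j g)
  convert! h with k
  rw [lam, Finset.mul_sum, Finset.sum_mul]
  refine Finset.sum_congr rfl fun j _ => ?_
  rw [isGrad_iff.1 hg j k]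
  simp only [norm_mul, mul_pow, Complex.norm_I, Complex.norm_real, Complex.norm_intCast, sq_abs, Real.norm_eq_abs,
    Complex.norm_ofNat]
  ring

lemma hasGrad_of_summable {f : L2 N} (h : Summable fun k => lam k * ‖coeff f k‖ ^ 2) :
    HasGrad f := by
  have : ∀ j : Fin N, ∃ g : L2 N, ∀ k, coeff g k =
      2 * (Real.pi : ℂ) * Complex.I * (k j : ℂ) * coeff f k := fun j => by
    apply exists_of_coeff
    · refine Summable.of_nonneg_of_le (fun _ => by positivity) (fun k => ?_) h
      have : ‖2 * (Real.pi : ℂ) * Complex.I * (k j : ℂ) * coeff f k‖ ^ 2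
          = (4 * Real.pi ^ 2 * (k j : ℝ) ^ 2) * ‖coeff f k‖ ^ 2 := by
        simp only [norm_mul, mul_pow, Complex.norm_I, Complex.norm_real, Complex.norm_intCast, sq_abs,
          Real.norm_eq_abs, Complex.norm_ofNat]
        ring
      rw [this, lam]
      gcongr
      exact Finset.single_le_sum (f := fun j => (k j : ℝ) ^ 2) (fun i _ => by positivity)
        (Finset.mem_univ j)
    · intro k
      rw [coeff_conj]
      simp only [map_mul, Complex.conj_I, Complex.conj_ofReal, Pi.neg_apply, Int.cast_neg,
        map_ofNat, map_intCast]
      ring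
  choose g hg using this
  refine ⟨∑ j, emb j (g j), isGrad_iff.2 fun i k => ?_⟩
  rw [map_sum]
  simp [comp_emb, hg]

lemma HasGrad.hasSum {f : L2 N} (h : HasGrad f) :
    HasSum (fun k => lam k * ‖coeff f k‖ ^ 2) (‖grad f‖ ^ 2) := h.isGrad.hasSum

lemma IsGrad.add {f₁ f₂ : L2 N} {g₁ g₂ : L2Vec N} (h₁ : IsGrad f₁ g₁) (h₂ : IsGrad f₂ g₂) :
    IsGrad (f₁ + f₂) (g₁ + g₂) := by
  rw [isGrad_iff] at *
  intro j k
  simp only [map_add, ← coeffL_apply] at *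
  rw [h₁, h₂, mul_add]

lemma IsGrad.sub {f₁ f₂ : L2 N} {g₁ g₂ : L2Vec N} (h₁ : IsGrad f₁ g₁) (h₂ : IsGrad f₂ g₂) :
    IsGrad (f₁ - f₂) (g₁ - g₂) := by
  rw [isGrad_iff] at *
  intro j k
  simp only [map_sub, ← coeffL_apply] at *
  rw [h₁, h₂, mul_sub]

lemma HasGrad.grad_sub {f₁ f₂ : L2 N} (h₁ : HasGrad f₁) (h₂ : HasGrad f₂) :
    grad (f₁ - f₂) = grad f₁ - grad f₂ := (h₁.isGrad.sub h₂.isGrad).grad_eq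

lemma HasGrad.add {f₁ f₂ : L2 N} (h₁ : HasGrad f₁) (h₂ : HasGrad f₂) : HasGrad (f₁ + f₂) :=
  (h₁.isGrad.add h₂.isGrad).hasGrad

lemma HasGrad.sub {f₁ f₂ : L2 N} (h₁ : HasGrad f₁) (h₂ : HasGrad f₂) : HasGrad (f₁ - f₂) :=
  (h₁.isGrad.sub h₂.isGrad).hasGrad

lemma coeff_const (c : ℝ) {k : Fin N → ℤ} (hk : k ≠ 0) :
    coeff (Lp.const 2 (volume : Measure (Torus N)) c) k = 0 := by
  have h1 : coeff (Lp.const 2 (volume : Measure (Torus N)) c) k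
      = coeff (fun _ : Torus N => c) k := coeff_congr (Lp.coeFn_const 2 volume c) k
  rw [h1, coeff]
  rw [integral_mul_const, integral_mFourier (neg_ne_zero.2 hk), zero_mul]

lemma isGrad_const (c : ℝ) : IsGrad (Lp.const 2 (volume : Measure (Torus N)) c) 0 := by
  rw [isGrad_iff]
  intro j k
  have : coeff (comp j (0 : L2Vec N)) k = 0 := by rw [map_zero, ← coeffL_apply, map_zero]
  rw [this]
  -- At k = 0 the factor k_j vanishes; at every other k the coefficient of a constant does.
  by_cases hk : k = 0
  · simp [hk]
  · rw [coeff_const c hk, mul_zero]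

/-- The gradient is a closed operator. -/
lemma isGrad_of_tendsto {ι : Type*} {l : Filter ι} [l.NeBot] {f : ι → L2 N} {g : ι → L2Vec N}
    {f₀ : L2 N} {g₀ : L2Vec N} (hf : Tendsto f l (𝓝 f₀)) (hg : Tendsto g l (𝓝 g₀))
    (h : ∀ i, IsGrad (f i) (g i)) : IsGrad f₀ g₀ := by
  rw [isGrad_iff]
  intro j k
  have h1 := (((coeffL k).continuous.comp (comp j).continuous).tendsto g₀).comp hg
  have h2 := (((coeffL k).continuous.tendsto f₀).comp hf).const_mul
    (2 * (Real.pi : ℂ) * Complex.I * (k j : ℂ))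
  have h3 := tendsto_nhds_unique (h1.congr fun i => ?_) h2
  · simpa [coeffL_apply] using h3
  · simpa [coeffL_apply] using isGrad_iff.1 (h i) j k

end

/-! ### The heat semigroup as a Fourier multiplier. -/

section

variable {N : ℕ}

lemma norm_le_of_coeff_le {f g : L2 N} {c : ℝ} (hc : 0 ≤ c)
    (h : ∀ k : Fin N → ℤ, ‖coeff f k‖ ≤ c * ‖coeff g k‖) : ‖f‖ ≤ c * ‖g‖ := by
  refine abs_le_of_sq_le_sq' ?_ (by positivity) |>.2
  rw [mul_pow]
  refine hasSum_le (fun k => ?_) (hasSum_coeff_sq f) ((hasSum_coeff_sq g).mul_left (c ^ 2))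
  rw [← mul_pow]
  exact pow_le_pow_left₀ (norm_nonneg _) (h k) 2

lemma integrable_mFourier_mul {f : Torus N → ℝ} (hf : Integrable f volume) (k : Fin N → ℤ) :
    Integrable (fun x => UnitAddTorus.mFourier k x * (f x : ℂ)) volume := by
  refine Integrable.bdd_mul (c := 1) hf.ofReal ?_ ?_
  · exact (UnitAddTorus.mFourier k).continuous.aestronglyMeasurable
  · exact .of_forall fun x => (UnitAddTorus.mFourier k).norm_coe_le_norm x |>.trans
      UnitAddTorus.mFourier_norm.le

lemma coeff_add {f g : Torus N → ℝ} (hf : Integrable f volume) (hg : Integrable g volume)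
    (k : Fin N → ℤ) : coeff (fun x => f x + g x) k = coeff f k + coeff g k := by
  unfold coeff
  rw [← integral_add (integrable_mFourier_mul hf _) (integrable_mFourier_mul hg _)]
  congr 1
  ext x
  push_cast
  ring

lemma coeff_sub {f g : Torus N → ℝ} (hf : Integrable f volume) (hg : Integrable g volume)
    (k : Fin N → ℤ) : coeff (fun x => f x - g x) k = coeff f k - coeff g k := by
  unfold coeff
  rw [← integral_sub (integrable_mFourier_mul hf _) (integrable_mFourier_mul hg _)]
  congr 1
  ext x
  push_cast
  ring

lemma norm_mFourier_apply (k : Fin N → ℤ) (x : Torus N) : ‖UnitAddTorus.mFourier k x‖ = 1 := by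
  simp only [UnitAddTorus.mFourier, fourier_apply, ContinuousMap.coe_mk, norm_prod,
    Circle.norm_coe, Finset.prod_const_one]

lemma norm_coeff_le (f : Torus N → ℝ) (k : Fin N → ℤ) : ‖coeff f k‖ ≤ ∫ x, |f x| := by
  refine (norm_integral_le_integral_norm _).trans_eq ?_
  congr 1
  ext x
  rw [norm_mul, norm_mFourier_apply, one_mul, Complex.norm_real, Real.norm_eq_abs]

lemma isHeat_iff {t : ℝ} {f : Torus N → ℝ} {g : L2 N} : IsHeat t f g ↔
    ∀ k : Fin N → ℤ, coeff g k = (Real.exp (-(t * lam k)) : ℂ) * coeff f k := by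
  unfold IsHeat lam
  refine forall_congr' fun k => ?_
  rw [show -(4 * Real.pi ^ 2 * t * ∑ j, (k j : ℝ) ^ 2)
    = -(t * (4 * Real.pi ^ 2 * ∑ j, (k j : ℝ) ^ 2)) by ring]

lemma IsHeat.heat_eq {t : ℝ} {f : Torus N → ℝ} {g : L2 N} (h : IsHeat t f g) : heat t f = g := by
  have h' : ∃ g : L2 N, IsHeat t f g := ⟨g, h⟩
  unfold heat
  rw [dif_pos h']
  exact eq_of_coeff_eq fun k => by rw [h'.choose_spec k, h k]

lemma isHeat_heat {t : ℝ} {f : Torus N → ℝ}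
    (h : Summable fun k : Fin N → ℤ => (Real.exp (-(t * lam k)) * ‖coeff f k‖) ^ 2) :
    IsHeat t f (heat t f) := by
  obtain ⟨g, hg⟩ := exists_of_coeff (N := N)
    (c := fun k => (Real.exp (-(t * lam k)) : ℂ) * coeff f k) (by
      simpa [← Complex.ofReal_exp] using h) (fun k => by
      rw [lam_neg, coeff_conj, map_mul, Complex.conj_ofReal])
  have : IsHeat t f g := isHeat_iff.2 hg
  rwa [this.heat_eq]

lemma exp_neg_mul_lam_le_one {t : ℝ} (ht : 0 ≤ t) (k : Fin N → ℤ) :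
    Real.exp (-(t * lam k)) ≤ 1 :=
  Real.exp_le_one_iff.2 (neg_nonpos.2 (mul_nonneg ht (lam_nonneg k)))

lemma isHeat_heat_L2 {t : ℝ} (ht : 0 ≤ t) (f : L2 N) : IsHeat t f (heat t f) := by
  apply isHeat_heat
  refine Summable.of_nonneg_of_le (fun _ => by positivity) (fun k => ?_) (hasSum_coeff_sq f).summable
  refine pow_le_pow_left₀ (by positivity) ?_ 2
  exact mul_le_of_le_one_left (norm_nonneg _) (exp_neg_mul_lam_le_one ht k)

lemma heat_congr {t : ℝ} {f g : Torus N → ℝ} (h : f =ᵐ[volume] g) : heat t f = heat t g := by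
  have : IsHeat t f = IsHeat (N := N) t g := by
    ext u
    simp only [IsHeat, coeff_congr h]
  unfold heat
  rw [this]

lemma coeff_heat_L2 {t : ℝ} (ht : 0 ≤ t) (f : L2 N) (k : Fin N → ℤ) :
    coeff (heat t f) k = (Real.exp (-(t * lam k)) : ℂ) * coeff f k :=
  isHeat_iff.1 (isHeat_heat_L2 ht f) k

lemma norm_heat_L2_le {t : ℝ} (ht : 0 ≤ t) (f : L2 N) : ‖heat t f‖ ≤ ‖f‖ := by
  rw [← one_mul ‖f‖]
  refine norm_le_of_coeff_le zero_le_one fun k => ?_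
  rw [coeff_heat_L2 ht, norm_mul, Complex.norm_real, Real.norm_of_nonneg (Real.exp_nonneg _)]
  exact mul_le_mul_of_nonneg_right (exp_neg_mul_lam_le_one ht k) (norm_nonneg _)

lemma heat_zero_L2 (f : L2 N) : heat 0 f = f := by
  refine IsHeat.heat_eq (isHeat_iff.2 fun k => ?_)
  simp

/-- The heat semigroup on `L²` as a continuous linear map. -/
def heatL (t : ℝ) (ht : 0 ≤ t) : L2 N →L[ℝ] L2 N :=
  LinearMap.mkContinuous
    { toFun := fun f => heat t f
      map_add' := fun f g => eq_of_coeff_eq fun k => by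
        rw [← coeffL_apply (heat t f + heat t g), map_add, coeffL_apply, coeffL_apply]
        simp only [coeff_heat_L2 ht]
        rw [← coeffL_apply, map_add, coeffL_apply, coeffL_apply, mul_add]
      map_smul' := fun c f => eq_of_coeff_eq fun k => by
        rw [← coeffL_apply, ← coeffL_apply, map_smul, coeffL_apply, coeffL_apply]
        simp only [coeff_heat_L2 ht, ← coeffL_apply, map_smul, RingHom.id_apply]
        simp only [Complex.real_smul]
        ring } 1 fun f => by
    rw [one_mul]
    exact norm_heat_L2_le ht f

lemma heatL_apply (t : ℝ) (ht : 0 ≤ t) (f : L2 N) : heatL t ht f = heat t f := rfl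

lemma summable_exp_neg_mul_int_sq {c : ℝ} (hc : 0 < c) :
    Summable fun n : ℤ => Real.exp (-(c * (n : ℝ) ^ 2)) := by
  have hnat : Summable fun n : ℕ => Real.exp (-(c * (n : ℝ) ^ 2)) := by
    have h1 : Summable fun n : ℕ => (Real.exp (-c)) ^ n :=
      summable_geometric_of_lt_one (Real.exp_nonneg _) (by rw [Real.exp_lt_one_iff]; linarith)
    refine Summable.of_nonneg_of_le (fun _ => Real.exp_nonneg _) (fun n => ?_) h1
    rw [← Real.exp_nat_mul]
    apply Real.exp_le_exp.2
    have : (n : ℝ) ≤ (n : ℝ) ^ 2 := by exact_mod_cast Nat.le_self_pow two_ne_zero n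
    nlinarith
  refine Summable.of_nat_of_neg ?_ ?_ <;> simpa using hnat

/-- The constant in the heat trace bound in dimension one. -/
def thetaC : ℝ := ∑' n : ℤ, Real.exp (-(1 / 8 * (n : ℝ) ^ 2))

lemma thetaC_nonneg : 0 ≤ thetaC := tsum_nonneg fun _ => Real.exp_nonneg _

/-- Poisson summation turns the sum into (8πt)^{-1/2} times the sum of exp(-n²/(8t)), and t ≤ 1
bounds the latter by `thetaC`. -/
lemma tsum_heat_one_le {t : ℝ} (ht : 0 < t) (ht1 : t ≤ 1) :
    ∑' n : ℤ, Real.exp (-(8 * Real.pi ^ 2 * t * (n : ℝ) ^ 2)) ≤ t ^ (-(1 / 2) : ℝ) * thetaC := by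
  have hpi := Real.pi_pos
  have h := Real.tsum_exp_neg_mul_int_sq (a := 8 * Real.pi * t) (by positivity)
  have e1 : ∀ n : ℤ, -Real.pi * (8 * Real.pi * t) * (n : ℝ) ^ 2
      = -(8 * Real.pi ^ 2 * t * (n : ℝ) ^ 2) := fun n => by ring
  have e2 : ∀ n : ℤ, -Real.pi / (8 * Real.pi * t) * (n : ℝ) ^ 2
      = -(1 / (8 * t) * (n : ℝ) ^ 2) := fun n => by field_simp
  simp_rw [e1, e2] at h
  rw [h]
  have h1 : (1 : ℝ) / (8 * Real.pi * t) ^ (1 / 2 : ℝ) ≤ t ^ (-(1 / 2) : ℝ) := by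
    rw [Real.rpow_neg ht.le, one_div]
    apply inv_anti₀ (by positivity)
    apply Real.rpow_le_rpow ht.le _ (by norm_num)
    nlinarith [Real.pi_gt_three]
  refine mul_le_mul h1 ?_ (tsum_nonneg fun _ => Real.exp_nonneg _) (by positivity)
  refine Summable.tsum_le_tsum (fun n => ?_) (summable_exp_neg_mul_int_sq (by positivity))
    (summable_exp_neg_mul_int_sq (by positivity))
  apply Real.exp_le_exp.2
  have : 1 / 8 ≤ 1 / (8 * t) := by
    apply one_div_le_one_div_of_le (by positivity); linarith
  have h2 : 0 ≤ (n : ℝ) ^ 2 := by positivity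
  nlinarith

/-- Over a box the sum factorises into one-dimensional ones, so s is enlarged to the box of its
projections. Squaring the multiplier turns 4π² into 8π². -/
lemma sum_heat_le {t : ℝ} (ht : 0 < t) (ht1 : t ≤ 1) (s : Finset (Fin N → ℤ)) :
    ∑ k ∈ s, Real.exp (-(t * lam k)) ^ 2 ≤ t ^ (-(N / 2) : ℝ) * thetaC ^ N := by
  classical
  have e : ∀ k : Fin N → ℤ, Real.exp (-(t * lam k)) ^ 2
      = ∏ j, Real.exp (-(8 * Real.pi ^ 2 * t * (k j : ℝ) ^ 2)) := fun k => by
    rw [← Real.exp_sum, ← Real.exp_nat_mul, lam, Finset.sum_neg_distrib, ← Finset.mul_sum]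
    congr 1
    push_cast
    ring
  simp_rw [e]
  have hsub : s ⊆ Fintype.piFinset fun j => s.image fun k => k j := fun k hk => by
    rw [Fintype.mem_piFinset]
    exact fun j => Finset.mem_image_of_mem _ hk
  refine (Finset.sum_le_sum_of_subset_of_nonneg hsub fun _ _ _ =>
    Finset.prod_nonneg fun _ _ => Real.exp_nonneg _).trans ?_
  rw [← Finset.prod_univ_sum (fun j => s.image fun k => k j)
    (fun (_ : Fin N) (n : ℤ) => Real.exp (-(8 * Real.pi ^ 2 * t * (n : ℝ) ^ 2)))]
  have h1 : t ^ (-(N / 2) : ℝ) * thetaC ^ N = ∏ _j : Fin N, (t ^ (-(1 / 2) : ℝ) * thetaC) := by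
    rw [Finset.prod_const, Finset.card_univ, Fintype.card_fin, mul_pow,
      ← Real.rpow_natCast (t ^ _), ← Real.rpow_mul ht.le]
    congr 2
    ring
  rw [h1]
  refine Finset.prod_le_prod (fun _ _ => Finset.sum_nonneg fun _ _ => Real.exp_nonneg _)
    fun j _ => ?_
  refine (Summable.sum_le_tsum _ (fun _ _ => Real.exp_nonneg _) ?_).trans (tsum_heat_one_le ht ht1)
  exact summable_exp_neg_mul_int_sq (by positivity)

lemma summable_heat {t : ℝ} (ht : 0 < t) :
    Summable fun k : Fin N → ℤ => Real.exp (-(t * lam k)) ^ 2 := by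
  have h1 : Summable fun k : Fin N → ℤ => Real.exp (-(min t 1 * lam k)) ^ 2 :=
    summable_of_sum_le (fun _ => by positivity)
      (sum_heat_le (lt_min ht one_pos) (min_le_right _ _))
  refine Summable.of_nonneg_of_le (fun _ => by positivity) (fun k => ?_) h1
  refine pow_le_pow_left₀ (Real.exp_nonneg _) (Real.exp_le_exp.2 ?_) 2
  have := mul_le_mul_of_nonneg_right (min_le_left t 1) (lam_nonneg k)
  linarith

/-- No integrability of f is needed: the coefficients are bounded uniformly in k by a Bochner
integral, whatever its value, and the Gaussian factor is square summable. -/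
lemma isHeat_heat_L1 {t : ℝ} (ht : 0 < t) (f : Torus N → ℝ) : IsHeat t f (heat t f) := by
  apply isHeat_heat
  refine Summable.of_nonneg_of_le (fun _ => by positivity) (fun k => ?_)
    ((summable_heat (N := N) ht).mul_right ((∫ x, |f x|) ^ 2))
  rw [mul_pow]
  exact mul_le_mul_of_nonneg_left (pow_le_pow_left₀ (norm_nonneg _) (norm_coeff_le f k) 2)
    (by positivity)

lemma coeff_heat {t : ℝ} (ht : 0 < t) (f : Torus N → ℝ) (k : Fin N → ℤ) :
    coeff (heat t f) k = (Real.exp (-(t * lam k)) : ℂ) * coeff f k :=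
  isHeat_iff.1 (isHeat_heat_L1 ht f) k

lemma norm_coeff_heat {t : ℝ} (ht : 0 < t) (f : Torus N → ℝ) (k : Fin N → ℤ) :
    ‖coeff (heat t f) k‖ = Real.exp (-(t * lam k)) * ‖coeff f k‖ := by
  rw [coeff_heat ht, norm_mul, Complex.norm_real, Real.norm_of_nonneg (Real.exp_nonneg _)]

lemma norm_heat_L1_le {t : ℝ} (ht : 0 < t) (ht1 : t ≤ 1) (f : Torus N → ℝ) :
    ‖heat t f‖ ≤ t ^ (-(N / 4) : ℝ) * Real.sqrt (thetaC ^ N) * ∫ x, |f x| := by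
  have hI : 0 ≤ ∫ x, |f x| := integral_nonneg fun _ => abs_nonneg _
  refine abs_le_of_sq_le_sq' ?_ (by positivity) |>.2
  rw [mul_pow, mul_pow, Real.sq_sqrt (pow_nonneg thetaC_nonneg _), ← Real.rpow_natCast (t ^ _),
    ← Real.rpow_mul ht.le, show (-(N / 4) * (2 : ℕ) : ℝ) = -(N / 2) by push_cast; ring,
    norm_sq_eq_tsum]
  refine Summable.tsum_le_of_sum_le (hasSum_coeff_sq _).summable fun s => ?_
  refine le_trans ?_ (mul_le_mul_of_nonneg_right (sum_heat_le ht ht1 s) (sq_nonneg _))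
  rw [Finset.sum_mul]
  refine Finset.sum_le_sum fun k _ => ?_
  rw [norm_coeff_heat ht, mul_pow]
  exact mul_le_mul_of_nonneg_left (pow_le_pow_left₀ (norm_nonneg _) (norm_coeff_le f k) 2)
    (by positivity)

lemma heat_add {t : ℝ} (ht : 0 < t) {f g : Torus N → ℝ} (hf : Integrable f volume)
    (hg : Integrable g volume) : heat t (fun x => f x + g x) = heat t f + heat t g :=
  eq_of_coeff_eq fun k => by
    rw [coeff_heat ht, coeff_add hf hg, ← coeffL_apply (_ + _), map_add, coeffL_apply,
      coeffL_apply, coeff_heat ht, coeff_heat ht, mul_add]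

lemma heat_sub {t : ℝ} (ht : 0 < t) {f g : Torus N → ℝ} (hf : Integrable f volume)
    (hg : Integrable g volume) : heat t (fun x => f x - g x) = heat t f - heat t g :=
  eq_of_coeff_eq fun k => by
    rw [coeff_heat ht, coeff_sub hf hg, ← coeffL_apply (_ - _), map_sub, coeffL_apply,
      coeffL_apply, coeff_heat ht, coeff_heat ht, mul_sub]

lemma heat_heat {t s : ℝ} (ht : 0 ≤ t) (hs : 0 < s) (f : Torus N → ℝ) :
    heat t (heat s f) = heat (t + s) f :=
  eq_of_coeff_eq fun k => by
    rw [coeff_heat_L2 ht, coeff_heat hs, coeff_heat (by linarith), ← mul_assoc,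
      ← Complex.ofReal_mul, ← Real.exp_add]
    congr 3
    ring

lemma heat_heat_L2 {t s : ℝ} (ht : 0 ≤ t) (hs : 0 ≤ s) (f : L2 N) :
    heat t (heat s f) = heat (t + s) f :=
  eq_of_coeff_eq fun k => by
    rw [coeff_heat_L2 ht, coeff_heat_L2 hs, coeff_heat_L2 (by linarith), ← mul_assoc,
      ← Complex.ofReal_mul, ← Real.exp_add]
    congr 3
    ring

lemma hasGrad_of_sum_le {f : L2 N} {M : ℝ} (hM : 0 ≤ M)
    (h : ∀ s : Finset (Fin N → ℤ), ∑ k ∈ s, lam k * ‖coeff f k‖ ^ 2 ≤ M ^ 2) :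
    HasGrad f ∧ ‖grad f‖ ≤ M := by
  have hs : Summable fun k => lam k * ‖coeff f k‖ ^ 2 :=
    summable_of_sum_le (fun k => mul_nonneg (lam_nonneg k) (by positivity)) h
  have hg := hasGrad_of_summable hs
  refine ⟨hg, abs_le_of_sq_le_sq' ?_ hM |>.2⟩
  rw [← hg.hasSum.tsum_eq]
  exact hs.tsum_le_of_sum_le h

/-- With x = t · `lam k`, the bound x e^{-2x} ≤ e^{-x} spends half of the decay on the gradient and
leaves the other half as the flow at time t/2. -/
lemma hasGrad_heat {t : ℝ} (ht : 0 < t) (f : Torus N → ℝ) :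
    HasGrad (heat t f) ∧ ‖grad (heat t f)‖ ≤ t ^ (-(1 / 2) : ℝ) * ‖heat (t / 2) f‖ := by
  refine hasGrad_of_sum_le (by positivity) fun s => ?_
  rw [mul_pow, ← Real.rpow_natCast (t ^ _), ← Real.rpow_mul ht.le,
    show (-(1 / 2) * (2 : ℕ) : ℝ) = -1 by norm_num, Real.rpow_neg_one, norm_sq_eq_tsum,
    ← tsum_mul_left]
  refine le_trans (Finset.sum_le_sum fun k _ => ?_)
    (((hasSum_coeff_sq (heat (t / 2) f)).summable.mul_left t⁻¹).sum_le_tsum s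
      fun _ _ => by positivity)
  rw [norm_coeff_heat ht, norm_coeff_heat (half_pos ht), mul_pow, mul_pow, ← mul_assoc, ← mul_assoc]
  refine mul_le_mul_of_nonneg_right ?_ (by positivity)
  rw [← Real.exp_nat_mul, ← Real.exp_nat_mul]
  have h1 : t * lam k ≤ Real.exp (t * lam k) := by
    linarith [Real.add_one_le_exp (t * lam k)]
  rw [inv_mul_eq_div, le_div_iff₀ ht]
  calc lam k * Real.exp ((2 : ℕ) * -(t * lam k)) * t
      = (t * lam k) * Real.exp ((2 : ℕ) * -(t * lam k)) := by ring
    _ ≤ Real.exp (t * lam k) * Real.exp ((2 : ℕ) * -(t * lam k)) := by gcongr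
    _ = Real.exp ((2 : ℕ) * -(t / 2 * lam k)) := by
      rw [← Real.exp_add]; congr 1; push_cast; ring

/-- For x ≥ 0 the number 1 - e^{-x} is at most both 1 and x, so its square is at most x; this is
Parseval with x = h · `lam k`. -/
lemma norm_heat_sub_le {h : ℝ} (hh : 0 ≤ h) {g : L2 N} (hg : HasGrad g) :
    ‖heat h g - g‖ ≤ Real.sqrt h * ‖grad g‖ := by
  refine abs_le_of_sq_le_sq' ?_ (by positivity) |>.2
  rw [mul_pow, Real.sq_sqrt hh]
  refine hasSum_le (fun k => ?_) (hasSum_coeff_sq _) (hg.hasSum.mul_left h)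
  rw [← coeffL_apply, map_sub, coeffL_apply, coeffL_apply, coeff_heat_L2 hh, ← sub_one_mul,
    norm_mul, mul_pow, ← mul_assoc]
  refine mul_le_mul_of_nonneg_right ?_ (by positivity)
  rw [← Complex.ofReal_one, ← Complex.ofReal_sub, Complex.norm_real, Real.norm_eq_abs, sq_abs]
  have h1 := exp_neg_mul_lam_le_one hh k
  have h2 := Real.add_one_le_exp (-(h * lam k))
  have h3 := Real.exp_nonneg (-(h * lam k))
  nlinarith

lemma tendsto_heat_zero (g : L2 N) : Tendsto (fun t => heat t g) (𝓝[≥] 0) (𝓝 g) := by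
  rw [tendsto_iff_norm_sub_tendsto_zero]
  have key : Tendsto (fun t => ‖heat t g - g‖ ^ 2) (𝓝[≥] 0) (𝓝 0) := by
    have h1 : ∀ t ∈ Ici (0 : ℝ), ∑' k : Fin N → ℤ,
        (Real.exp (-(t * lam k)) - 1) ^ 2 * ‖coeff g k‖ ^ 2 = ‖heat t g - g‖ ^ 2 := fun t ht => by
      rw [norm_sq_eq_tsum]
      congr 1
      ext k
      rw [← coeffL_apply (_ - _), map_sub, coeffL_apply, coeffL_apply, coeff_heat_L2 ht,
        ← sub_one_mul, norm_mul, mul_pow, ← Complex.ofReal_one, ← Complex.ofReal_sub,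
        Complex.norm_real, Real.norm_eq_abs, sq_abs]
    refine Tendsto.congr' (eventually_nhdsWithin_of_forall h1) ?_
    have h2 : Tendsto (fun t => ∑' k : Fin N → ℤ,
        (Real.exp (-(t * lam k)) - 1) ^ 2 * ‖coeff g k‖ ^ 2) (𝓝[≥] 0)
        (𝓝 (∑' _k : Fin N → ℤ, 0)) := ?_
    · simpa using h2
    refine tendsto_tsum_of_dominated_convergence (hasSum_coeff_sq g).summable (fun k => ?_) ?_
    · have : Continuous fun t : ℝ => (Real.exp (-(t * lam k)) - 1) ^ 2 * ‖coeff g k‖ ^ 2 := by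
        fun_prop
      have := this.tendsto 0
      simp only [zero_mul, neg_zero, Real.exp_zero, sub_self, ne_eq, OfNat.ofNat_ne_zero,
        not_false_eq_true, zero_pow] at this
      exact this.mono_left nhdsWithin_le_nhds
    · refine eventually_nhdsWithin_of_forall fun t ht k => ?_
      rw [Real.norm_of_nonneg (by positivity)]
      refine mul_le_of_le_one_left (by positivity) ?_
      have h1 := exp_neg_mul_lam_le_one ht k
      have h3 := Real.exp_nonneg (-(t * lam k))
      nlinarith
  have := key.sqrt
  simpa [Real.sqrt_sq (norm_nonneg _)] using this

/-- `f` is measurable and `‖f‖_{L^{2/p}} ≤ n`. -/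
def BddLr (p : ℝ) (f : Torus N → ℝ) (n : ℝ) : Prop :=
  AEStronglyMeasurable f volume ∧ eLpNorm f (2 / ENNReal.ofReal p) volume ≤ ENNReal.ofReal n

/-- The constant of the smoothing estimate `L^{2/p} → L²`. -/
def smoothC (N : ℕ) : ℝ := Real.sqrt (thetaC ^ N) + 1

lemma smoothC_pos (N : ℕ) : 0 < smoothC N := by unfold smoothC; positivity

lemma norm_sq_eq_integral (f : L2 N) : ‖f‖ ^ 2 = ∫ x, f x ^ 2 := by
  rw [← real_inner_self_eq_norm_sq, L2.inner_def]
  congr 1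
  ext x
  rw [real_inner_self_eq_norm_sq, Real.norm_eq_abs, sq_abs]

lemma norm_heat_le_of_memLp {t : ℝ} (ht : 0 ≤ t) {f : Torus N → ℝ} (hf : MemLp f 2 volume)
    {M : ℝ} (hM : 0 ≤ M) (h : ∫ x, f x ^ 2 ≤ M ^ 2) : ‖heat t f‖ ≤ M := by
  rw [← heat_congr hf.coeFn_toLp]
  refine (norm_heat_L2_le ht _).trans (abs_le_of_sq_le_sq' ?_ hM |>.2)
  rw [norm_sq_eq_integral]
  refine le_trans (le_of_eq (integral_congr_ae ?_)) h
  filter_upwards [hf.coeFn_toLp] with x hx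
  rw [hx]

/-! ### Smoothing from L^{2/p} to L² by truncation. -/

section Smoothing

variable {p : ℝ}

lemma two_div_ofReal (hp : 1 ≤ p) : (2 : ℝ≥0∞) / ENNReal.ofReal p = ENNReal.ofReal (2 / p) := by
  rw [ENNReal.ofReal_div_of_pos (by linarith), ENNReal.ofReal_ofNat]

lemma BddLr.memLp {f : Torus N → ℝ} {n : ℝ} (h : BddLr p f n) :
    MemLp f (2 / ENNReal.ofReal p) volume := ⟨h.1, h.2.trans_lt ENNReal.ofReal_lt_top⟩

lemma one_le_two_div (hp : 1 ≤ p) (hp2 : p ≤ 2) : (1 : ℝ≥0∞) ≤ 2 / ENNReal.ofReal p := by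
  rw [two_div_ofReal hp, ENNReal.one_le_ofReal, le_div_iff₀ (by linarith)]
  linarith

lemma BddLr.integrable {f : Torus N → ℝ} {n : ℝ} (h : BddLr p f n) (hp : 1 ≤ p) (hp2 : p ≤ 2) :
    Integrable f volume := h.memLp.integrable (one_le_two_div hp hp2)

lemma BddLr.integrable_rpow {f : Torus N → ℝ} {n : ℝ} (h : BddLr p f n) (hp : 1 ≤ p) :
    Integrable (fun x => |f x| ^ (2 / p)) volume := by
  have h1 := h.memLp
  rw [two_div_ofReal hp] at h1
  have hr : 0 < 2 / p := by positivity
  simpa [ENNReal.toReal_ofReal hr.le] using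
    h1.integrable_norm_rpow (by simpa using hr) ENNReal.ofReal_ne_top

lemma BddLr.integral_rpow_le {f : Torus N → ℝ} {n : ℝ} (h : BddLr p f n) (hp : 1 ≤ p)
    (hn : 0 ≤ n) : ∫ x, |f x| ^ (2 / p) ≤ n ^ (2 / p) := by
  have h1 := h.memLp
  have h2 := h.2
  rw [two_div_ofReal hp] at h1 h2
  have hr : 0 < 2 / p := by positivity
  rw [h1.eLpNorm_eq_integral_rpow_norm (by simpa using hr) ENNReal.ofReal_ne_top,
    ENNReal.ofReal_le_ofReal_iff hn, ENNReal.toReal_ofReal hr.le] at h2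
  exact (Real.rpow_inv_le_iff_of_pos (integral_nonneg fun _ => by positivity) hn hr).1 h2

/-- A hands-on interpolation between L¹ → L² and L² → L²: f is cut at height L, the tall part is
measured in L¹ and the rest in L², each through the integral of |f|^{2/p}. -/
lemma norm_heat_le_of_pos {f : Torus N → ℝ} {n t : ℝ} (hp : 1 ≤ p) (hp2 : p ≤ 2) (ht : 0 < t)
    (ht1 : t ≤ 1) (hf : BddLr p f n) (hn : 0 < n) :
    ‖heat t f‖ ≤ smoothC N * t ^ (-(N * (p - 1) / 4)) * n := by
  set r := 2 / p with hr
  have hr1 : 1 ≤ r := by rw [hr, le_div_iff₀ (by linarith)]; linarith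
  have hr2 : r ≤ 2 := by rw [hr, div_le_iff₀ (by linarith)]; linarith
  -- This height balances the two parts: both then contribute t^{-N(p-1)/4} n.
  set L := t ^ (-(N * p / 4)) * n with hL
  have hL0 : 0 < L := by positivity
  have hfi := hf.integrable hp hp2
  -- The level set is that of the measurable representative, so that it is a measurable set.
  obtain ⟨A, hA⟩ : ∃ A : Set (Torus N), A = {x | L < |hfi.1.mk f x|} := ⟨_, rfl⟩
  have hAm : MeasurableSet A := by
    rw [hA]
    exact measurableSet_lt measurable_const hfi.1.stronglyMeasurable_mk.measurable.abs
  have hmk := hfi.1.ae_eq_mk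
  have hIr := hf.integrable_rpow hp
  have hIn := hf.integral_rpow_le hp hn.le
  have hf1 : Integrable (A.indicator f) volume := hfi.indicator hAm
  have hf2 : Integrable (Aᶜ.indicator f) volume := hfi.indicator hAm.compl
  have hsum : heat t f = heat t (A.indicator f) + heat t (Aᶜ.indicator f) := by
    rw [← heat_add ht hf1 hf2]
    congr 1
    ext x
    exact (congrFun (Set.indicator_self_add_compl A f) x).symm
  have b1 : ∫ x, |A.indicator f x| ≤ L ^ (1 - r) * n ^ r := by
    refine le_trans ?_ (mul_le_mul_of_nonneg_left hIn (by positivity))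
    rw [← integral_const_mul]
    refine integral_mono_ae hf1.abs (hIr.const_mul _) ?_
    filter_upwards [hmk] with x hx
    by_cases hxA : x ∈ A
    · simp only [Set.indicator_of_mem hxA]
      rw [hA, mem_ofPred_eq, ← hx] at hxA
      have hpos : 0 < |f x| := hL0.trans hxA
      calc |f x| = |f x| ^ (1 - r) * |f x| ^ r := by
            rw [← Real.rpow_add hpos, sub_add_cancel, Real.rpow_one]
        _ ≤ L ^ (1 - r) * |f x| ^ r := by
            refine mul_le_mul_of_nonneg_right ?_ (by positivity)
            exact Real.rpow_le_rpow_of_nonpos hL0 hxA.le (by linarith)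
    · simp only [Set.indicator_of_notMem hxA, abs_zero]
      positivity
  have p2 : ∀ᵐ x, (Aᶜ.indicator f x) ^ 2 ≤ L ^ (2 - r) * |f x| ^ r := by
    filter_upwards [hmk] with x hx
    by_cases hxA : x ∈ Aᶜ
    · simp only [Set.indicator_of_mem hxA]
      rw [hA, mem_compl_iff, mem_ofPred_eq, ← hx, not_lt] at hxA
      calc f x ^ 2 = |f x| ^ (2 - r) * |f x| ^ r := by
            rw [← Real.rpow_add_of_nonneg (abs_nonneg _) (by linarith) (by linarith),
              sub_add_cancel, Real.rpow_two, sq_abs]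
        _ ≤ L ^ (2 - r) * |f x| ^ r := by
            refine mul_le_mul_of_nonneg_right ?_ (by positivity)
            exact Real.rpow_le_rpow (abs_nonneg _) hxA (by linarith)
    · simp only [Set.indicator_of_notMem hxA, ne_eq, OfNat.ofNat_ne_zero, not_false_eq_true,
        zero_pow]
      positivity
  have hi2 : Integrable (fun x => (Aᶜ.indicator f x) ^ 2) volume := by
    refine Integrable.mono' (hIr.const_mul (L ^ (2 - r))) (hf2.1.pow 2) ?_
    filter_upwards [p2] with x hx
    rwa [Real.norm_of_nonneg (by positivity)]
  have b2 : ∫ x, (Aᶜ.indicator f x) ^ 2 ≤ L ^ (2 - r) * n ^ r := by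
    refine le_trans ?_ (mul_le_mul_of_nonneg_left hIn (by positivity))
    rw [← integral_const_mul]
    exact integral_mono_ae hi2 (hIr.const_mul _) p2
  have hm2 : MemLp (Aᶜ.indicator f) 2 volume := (memLp_two_iff_integrable_sq hf2.1).2 hi2
  have hLr : ∀ e : ℝ, L ^ (e - r) * n ^ r = t ^ (-(N * p / 4) * (e - r)) * n ^ e := fun e => by
    rw [hL, Real.mul_rpow (by positivity) hn.le, ← Real.rpow_mul ht.le, mul_assoc,
      ← Real.rpow_add hn, sub_add_cancel]
  have c1 : ‖heat t (A.indicator f)‖ ≤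
      Real.sqrt (thetaC ^ N) * t ^ (-(N * (p - 1) / 4)) * n := by
    refine (norm_heat_L1_le ht ht1 _).trans ?_
    refine (mul_le_mul_of_nonneg_left b1 (by positivity)).trans_eq ?_
    rw [hLr, Real.rpow_one, mul_comm (t ^ _) (Real.sqrt _), mul_assoc, ← mul_assoc (t ^ _),
      ← Real.rpow_add ht, ← mul_assoc]
    congr 3
    rw [hr]
    field_simp
    ring
  have c2 : ‖heat t (Aᶜ.indicator f)‖ ≤ t ^ (-(N * (p - 1) / 4)) * n := by
    refine norm_heat_le_of_memLp ht.le hm2 (by positivity) (b2.trans_eq ?_)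
    rw [hLr, Real.rpow_two, mul_pow, ← Real.rpow_natCast (t ^ _), ← Real.rpow_mul ht.le]
    congr 2
    rw [hr]
    field_simp
    push_cast
    ring
  rw [hsum]
  refine (norm_add_le _ _).trans ((add_le_add c1 c2).trans_eq ?_)
  unfold smoothC
  ring

/-- Smoothing of the heat semigroup from `L^{2/p}` to `L²`. -/
lemma norm_heat_le {f : Torus N → ℝ} {n t : ℝ} (hp : 1 ≤ p) (hp2 : p ≤ 2) (ht : 0 < t)
    (ht1 : t ≤ 1) (hf : BddLr p f n) (hn : 0 ≤ n) :
    ‖heat t f‖ ≤ smoothC N * t ^ (-(N * (p - 1) / 4)) * n := by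
  -- The truncation needs a positive bound; n = 0 is reached by letting m decrease to n.
  have h1 : Tendsto (fun m : ℝ => smoothC N * t ^ (-(N * (p - 1) / 4)) * m) (𝓝[>] n)
      (𝓝 (smoothC N * t ^ (-(N * (p - 1) / 4)) * n)) :=
    ((continuous_const.mul continuous_id).tendsto n).mono_left nhdsWithin_le_nhds
  refine ge_of_tendsto h1 (eventually_nhdsWithin_of_forall fun m hm => ?_)
  exact norm_heat_le_of_pos hp hp2 ht ht1
    ⟨hf.1, hf.2.trans (ENNReal.ofReal_le_ofReal (le_of_lt hm))⟩ (hn.trans_lt hm)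

end Smoothing

end

section

variable {N : ℕ}

/-! ### Measurability in time, coefficient by coefficient. -/

section Measurability

variable {α : Type*} [MeasurableSpace α] {μ : Measure α}

/-- The Fourier series is a pointwise limit of finite sums of measurable scalars times fixed
vectors. It lives in complex L², and `reL` brings the result back. -/
lemma aestronglyMeasurable_of_coeff {h : α → L2 N}
    (H : ∀ k : Fin N → ℤ, AEStronglyMeasurable (fun a => coeff (h a) k) μ) :
    AEStronglyMeasurable h μ := by
  have h1 : AEStronglyMeasurable (fun a => toC (h a)) μ := by
    refine aestronglyMeasurable_of_tendsto_ae (atTop : Filter (Finset (Fin N → ℤ)))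
      (f := fun s a => ∑ k ∈ s, coeff (h a) k • fourierBasis k) (fun s => ?_)
      (.of_forall fun a => ?_)
    · exact Finset.aestronglyMeasurable_fun_sum s fun k _ => (H k).smul_const _
    · have := fourierBasis.hasSum_repr (toC (h a))
      simp only [← coeff_eq_repr] at this
      exact this
  have h2 := reL.continuous.comp_aestronglyMeasurable h1
  simpa only [Function.comp_def, reL_toC] using h2

lemma AEStronglyMeasurable.coeff {h : α → L2 N} (H : AEStronglyMeasurable h μ)
    (k : Fin N → ℤ) : AEStronglyMeasurable (fun a => coeff (h a) k) μ := by
  simpa only [coeffL_apply] using (coeffL k).continuous.comp_aestronglyMeasurable H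

lemma aestronglyMeasurable_grad {u : α → L2 N} (hu : AEStronglyMeasurable u μ)
    (hg : ∀ᵐ a ∂μ, HasGrad (u a)) : AEStronglyMeasurable (fun a => grad (u a)) μ := by
  have h1 : ∀ j : Fin N, AEStronglyMeasurable (fun a => comp j (grad (u a))) μ := fun j => by
    refine aestronglyMeasurable_of_coeff fun k => ?_
    refine ((AEStronglyMeasurable.coeff hu k).const_mul
      (2 * (Real.pi : ℂ) * Complex.I * (k j : ℂ))).congr ?_
    filter_upwards [hg] with a ha
    exact (isGrad_iff.1 ha.isGrad j k).symm
  have h2 : AEStronglyMeasurable (fun a => ∑ j, emb j (comp j (grad (u a)))) μ :=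
    Finset.aestronglyMeasurable_fun_sum _ fun j _ =>
      (emb j).continuous.comp_aestronglyMeasurable (h1 j)
  simpa only [sum_emb_comp] using h2

lemma aestronglyMeasurable_heat {s : α → ℝ} (hs : Measurable s) (hs0 : ∀ᵐ a ∂μ, 0 < s a)
    {F : α → Torus N → ℝ} (hF : ∀ k, AEStronglyMeasurable (fun a => coeff (F a) k) μ) :
    AEStronglyMeasurable (fun a => heat (s a) (F a)) μ := by
  refine aestronglyMeasurable_of_coeff fun k => ?_
  have h1 : Measurable fun a => (Real.exp (-(s a * lam k)) : ℂ) := by fun_prop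
  refine (h1.aestronglyMeasurable.mul (hF k)).congr ?_
  filter_upwards [hs0] with a ha
  exact (coeff_heat ha _ k).symm

/-- Components and coefficients are continuous linear maps, hence commute with the Bochner integral.
-/
lemma isGrad_integral {F : α → L2 N} (hF : Integrable F μ) (hg : ∀ᵐ a ∂μ, HasGrad (F a))
    (hG : Integrable (fun a => grad (F a)) μ) :
    IsGrad (∫ a, F a ∂μ) (∫ a, grad (F a) ∂μ) := by
  rw [isGrad_iff]
  intro j k
  rw [← coeffL_apply, ← coeffL_apply, ← (comp j).integral_comp_comm hG,
    ← (coeffL k).integral_comp_comm ((comp j).integrable_comp hG),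
    ← (coeffL k).integral_comp_comm hF, ← integral_const_mul]
  apply integral_congr_ae
  filter_upwards [hg] with a ha
  rw [coeffL_apply, coeffL_apply, isGrad_iff.1 ha.isGrad j k]

end Measurability

/-! ### Duhamel integrals with a source of size τ^{-1/2} in L^{2/p}. -/

/-- The singular kernel dominating the Duhamel integrals. -/
def ker (b t τ : ℝ) : ℝ := (t - τ) ^ (-b) + τ ^ (-b)

/-- Replacing the larger of t - τ and τ by the smaller one in its negative power collects the whole
exponent b on a single factor. -/
lemma mul_le_ker {b t τ : ℝ} (hb : 1 / 2 ≤ b) (h0 : 0 < τ) (h1 : τ < t) :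
    (t - τ) ^ (-(b - 1 / 2)) * τ ^ (-(1 / 2) : ℝ) ≤ ker b t τ := by
  have h2 := sub_pos.2 h1
  unfold ker
  rcases le_total (t - τ) τ with h | h
  · calc _ ≤ (t - τ) ^ (-(b - 1 / 2)) * (t - τ) ^ (-(1 / 2) : ℝ) := by
          refine mul_le_mul_of_nonneg_left ?_ (by positivity)
          exact Real.rpow_le_rpow_of_nonpos h2 h (by norm_num)
      _ = (t - τ) ^ (-b) := by rw [← Real.rpow_add h2]; congr 1; ring
      _ ≤ _ := le_add_of_nonneg_right (by positivity)
  · calc _ ≤ τ ^ (-(b - 1 / 2)) * τ ^ (-(1 / 2) : ℝ) := by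
          refine mul_le_mul_of_nonneg_right ?_ (by positivity)
          exact Real.rpow_le_rpow_of_nonpos h0 h (by linarith)
      _ = τ ^ (-b) := by rw [← Real.rpow_add h0]; congr 1; ring
      _ ≤ _ := le_add_of_nonneg_left (by positivity)

lemma intervalIntegrable_ker {b : ℝ} (hb : b < 1) (s t : ℝ) :
    IntervalIntegrable (ker b t) volume s t := by
  unfold ker
  refine IntervalIntegrable.add ?_ (intervalIntegral.intervalIntegrable_rpow' (by linarith))
  have h : IntervalIntegrable (fun x : ℝ => x ^ (-b)) volume (t - s) (t - t) :=
    intervalIntegral.intervalIntegrable_rpow' (by linarith)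
  have := h.comp_sub_left t
  simpa using this

/-- Subadditivity of x ↦ x^{1-b} bounds t^{1-b} - s^{1-b} by (t-s)^{1-b}. The resulting uniformity
in s is what uniqueness on successive windows requires. -/
lemma integral_ker_le {b s t : ℝ} (hb0 : 0 ≤ b) (hb : b < 1) (hs : 0 ≤ s) (hst : s ≤ t) :
    ∫ τ in s..t, ker b t τ ≤ 2 / (1 - b) * (t - s) ^ (1 - b) := by
  have hb1 : 0 < 1 - b := by linarith
  have hts := sub_nonneg.2 hst
  have i1 : IntervalIntegrable (fun x : ℝ => (t - x) ^ (-b)) volume s t := by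
    have h : IntervalIntegrable (fun x : ℝ => x ^ (-b)) volume (t - s) (t - t) :=
      intervalIntegral.intervalIntegrable_rpow' (by linarith)
    have := h.comp_sub_left t
    simpa using this
  have e : -b + 1 = 1 - b := by ring
  have h1 : ∫ τ in s..t, (t - τ) ^ (-b) = (t - s) ^ (1 - b) / (1 - b) := by
    rw [intervalIntegral.integral_comp_sub_left (fun x => x ^ (-b)) t, sub_self,
      integral_rpow (Or.inl (by linarith)), e, Real.zero_rpow hb1.ne', sub_zero]
  have h2 : ∫ τ in s..t, τ ^ (-b) ≤ (t - s) ^ (1 - b) / (1 - b) := by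
    rw [integral_rpow (Or.inl (by linarith)), e]
    gcongr
    have := Real.rpow_add_le_add_rpow hts hs hb1.le (by linarith)
    rw [sub_add_cancel] at this
    linarith
  unfold ker
  rw [intervalIntegral.integral_add i1 (intervalIntegral.intervalIntegrable_rpow' (by linarith)), h1]
  calc _ ≤ (t - s) ^ (1 - b) / (1 - b) + (t - s) ^ (1 - b) / (1 - b) := by gcongr
    _ = _ := by ring

/-- The singularity exponent of the gradient of the Duhamel term. -/
def expB (N : ℕ) (p : ℝ) : ℝ := N * (p - 1) / 4 + 1 / 2

/-- The constant of the Duhamel estimate. -/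
def duhC (N : ℕ) (p : ℝ) : ℝ := 8 * smoothC N / (1 - expB N p)

section Duhamel

variable {p : ℝ}

lemma half_le_expB (hp : 1 ≤ p) : 1 / 2 ≤ expB N p := by
  have := sub_nonneg.2 hp
  have : 0 ≤ N * (p - 1) / 4 := by positivity
  unfold expB; linarith

lemma duhC_pos (hb : expB N p < 1) : 0 < duhC N p := by
  have := smoothC_pos N
  have := sub_pos.2 hb
  unfold duhC; positivity

lemma norm_heat_le_ker {s t K : ℝ} (hp : 1 ≤ p) (hp2 : p ≤ 2) (ht1 : t ≤ 1)
    (hK : 0 ≤ K) {f : Torus N → ℝ} (h0 : 0 < s) (hst : s < t)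
    (hf : BddLr p f (K * s ^ (-(1 / 2) : ℝ))) :
    ‖heat (t - s) f‖ ≤ smoothC N * K * ker (expB N p) t s := by
  have hts := sub_pos.2 hst
  refine (norm_heat_le hp hp2 hts (by linarith) hf (by positivity)).trans ?_
  have := mul_le_ker (half_le_expB (N := N) hp) h0 hst
  calc _ = smoothC N * K * ((t - s) ^ (-(expB N p - 1 / 2)) * s ^ (-(1 / 2) : ℝ)) := by
        unfold expB; rw [add_sub_cancel_right]; ring
    _ ≤ _ := mul_le_mul_of_nonneg_left this (mul_nonneg (smoothC_pos N).le hK)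

/-- The weight is split as √t ≤ (t-s)^{1/2} + s^{1/2}: the first term cancels the singularity of the
gradient, the second that of the source, and what is left in each case is dominated by the kernel.
Running the smoothing for time (t-s)/2 costs a factor 2. -/
lemma norm_grad_heat_le_ker {s t K : ℝ} (hp : 1 ≤ p) (hp2 : p ≤ 2) (hb : expB N p < 1)
    (ht1 : t ≤ 1) (hK : 0 ≤ K) {f : Torus N → ℝ} (h0 : 0 < s) (hst : s < t)
    (hf : BddLr p f (K * s ^ (-(1 / 2) : ℝ))) :
    Real.sqrt t * ‖grad (heat (t - s) f)‖ ≤ 4 * smoothC N * K * ker (expB N p) t s := by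
  have hts := sub_pos.2 hst
  have hb2 := half_le_expB (N := N) hp
  have hC := smoothC_pos N
  set b := expB N p with hbd
  have ha : (N : ℝ) * (p - 1) / 4 = b - 1 / 2 := by rw [hbd, expB]; ring
  have h1 := (hasGrad_heat hts f).2
  have h2 := norm_heat_le hp hp2 (half_pos hts) (by linarith) hf (by positivity)
  rw [ha] at h2
  have h3 : ((t - s) / 2) ^ (-(b - 1 / 2)) ≤ 2 * (t - s) ^ (-(b - 1 / 2)) := by
    rw [Real.div_rpow hts.le (by norm_num), div_eq_mul_inv, ← Real.rpow_neg (by norm_num), neg_neg,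
      mul_comm]
    gcongr
    calc (2 : ℝ) ^ (b - 1 / 2) ≤ 2 ^ (1 : ℝ) :=
          Real.rpow_le_rpow_of_exponent_le (by norm_num) (by linarith)
      _ = 2 := Real.rpow_one 2
  have h4 : Real.sqrt t ≤ (t - s) ^ (1 / 2 : ℝ) + s ^ (1 / 2 : ℝ) := by
    rw [Real.sqrt_eq_rpow]
    have := Real.rpow_add_le_add_rpow hts.le h0.le (p := 1 / 2) (by norm_num) (by norm_num)
    rwa [sub_add_cancel] at this
  have h5 := mul_le_ker hb2 h0 hst
  have e1 : (t - s) ^ (-(1 / 2) : ℝ) * (t - s) ^ (1 / 2 : ℝ) = 1 := by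
    rw [← Real.rpow_add hts]; simp
  have e2 : s ^ (-(1 / 2) : ℝ) * s ^ (1 / 2 : ℝ) = 1 := by
    rw [← Real.rpow_add h0]; simp
  have e3 : (t - s) ^ (-(1 / 2) : ℝ) * (t - s) ^ (-(b - 1 / 2)) = (t - s) ^ (-b) := by
    rw [← Real.rpow_add hts]; congr 1; ring
  calc Real.sqrt t * ‖grad (heat (t - s) f)‖
      ≤ ((t - s) ^ (1 / 2 : ℝ) + s ^ (1 / 2 : ℝ)) * ((t - s) ^ (-(1 / 2) : ℝ) *
        (smoothC N * (2 * (t - s) ^ (-(b - 1 / 2))) * (K * s ^ (-(1 / 2) : ℝ)))) := by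
        refine mul_le_mul h4 (h1.trans ?_) (norm_nonneg _) (by positivity)
        refine mul_le_mul_of_nonneg_left (h2.trans ?_) (by positivity)
        gcongr
    _ = 2 * smoothC N * K * (((t - s) ^ (-(1 / 2) : ℝ) * (t - s) ^ (1 / 2 : ℝ)) *
          ((t - s) ^ (-(b - 1 / 2)) * s ^ (-(1 / 2) : ℝ)) +
        (s ^ (-(1 / 2) : ℝ) * s ^ (1 / 2 : ℝ)) *
          ((t - s) ^ (-(1 / 2) : ℝ) * (t - s) ^ (-(b - 1 / 2)))) := by ring
    _ ≤ 2 * smoothC N * K * (ker b t s + ker b t s) := by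
        rw [e1, e2, e3, one_mul, one_mul]
        gcongr
        exact le_add_of_nonneg_right (by positivity)
    _ = _ := by ring

/-- Discards the endpoint τ = t, where the source need not be in L² and `heat` may take its default
value. -/
lemma ae_Ioc_lt (s t : ℝ) : ∀ᵐ τ ∂(volume.restrict (Ioc s t)), s < τ ∧ τ < t := by
  rw [← restrict_Ioo_eq_restrict_Ioc]
  exact ae_restrict_mem measurableSet_Ioo

/-- The hypotheses on the source term of a Duhamel integral over `(s, t)`. -/
structure Source (p : ℝ) (F : ℝ → Torus N → ℝ) (K s t : ℝ) : Prop where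
  bound : ∀ᵐ τ ∂(volume.restrict (Ioc s t)), BddLr p (F τ) (K * τ ^ (-(1 / 2) : ℝ))
  meas : ∀ k, AEStronglyMeasurable (fun τ => coeff (F τ) k) (volume.restrict (Ioc s t))

lemma Source.mono {F : ℝ → Torus N → ℝ} {K s t s' t' : ℝ} (h : Source p F K s t) (hs : s ≤ s')
    (ht : t' ≤ t) : Source p F K s' t' where
  bound := ae_restrict_of_ae_restrict_of_subset (Ioc_subset_Ioc hs ht) h.bound
  meas k := (h.meas k).mono_set (Ioc_subset_Ioc hs ht)

variable {F : ℝ → Torus N → ℝ} {K s t : ℝ}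

lemma Source.aestronglyMeasurable (h : Source p F K s t) :
    AEStronglyMeasurable (fun τ => heat (t - τ) (F τ)) (volume.restrict (Ioc s t)) := by
  refine aestronglyMeasurable_heat (by fun_prop) ?_ h.meas
  filter_upwards [ae_Ioc_lt s t] with τ hτ
  linarith

lemma Source.norm_le (h : Source p F K s t) (hp : 1 ≤ p) (hp2 : p ≤ 2) (hK : 0 ≤ K) (hs : 0 ≤ s)
    (ht : t ≤ 1) : ∀ᵐ τ ∂(volume.restrict (Ioc s t)),
      ‖heat (t - τ) (F τ)‖ ≤ smoothC N * K * ker (expB N p) t τ := by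
  filter_upwards [ae_Ioc_lt s t, h.bound] with τ hτ hF
  exact norm_heat_le_ker hp hp2 ht hK (by linarith) hτ.2 hF

lemma Source.intervalIntegrable (h : Source p F K s t) (hp : 1 ≤ p) (hp2 : p ≤ 2)
    (hb : expB N p < 1) (hK : 0 ≤ K) (hs : 0 ≤ s) (hst : s ≤ t) (ht : t ≤ 1) :
    IntervalIntegrable (fun τ => heat (t - τ) (F τ)) volume s t := by
  have hk := (intervalIntegrable_ker hb s t).const_mul (smoothC N * K)
  rw [intervalIntegrable_iff_integrableOn_Ioc_of_le hst] at hk ⊢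
  exact Integrable.mono' hk h.aestronglyMeasurable (h.norm_le hp hp2 hK hs ht)

lemma Source.norm_integral_le (h : Source p F K s t) (hp : 1 ≤ p) (hp2 : p ≤ 2)
    (hb : expB N p < 1) (hK : 0 ≤ K) (hs : 0 ≤ s) (hst : s ≤ t) (ht : t ≤ 1) :
    ‖∫ τ in s..t, heat (t - τ) (F τ)‖ ≤ duhC N p * K * (t - s) ^ (1 - expB N p) := by
  have hC := smoothC_pos N
  have hb1 := sub_pos.2 hb
  have hts := sub_nonneg.2 hst
  have hk := (intervalIntegrable_ker hb s t).const_mul (smoothC N * K)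
  have h1 := h.norm_le hp hp2 hK hs ht
  rw [ae_restrict_iff' measurableSet_Ioc] at h1
  refine (intervalIntegral.norm_integral_le_of_norm_le hst h1 hk).trans ?_
  rw [intervalIntegral.integral_const_mul]
  have h2 := integral_ker_le (by linarith [half_le_expB (N := N) hp]) hb hs hst
  refine (mul_le_mul_of_nonneg_left h2 (by positivity)).trans ?_
  calc _ = (2 * smoothC N / (1 - expB N p)) * K * (t - s) ^ (1 - expB N p) := by ring
    _ ≤ _ := by unfold duhC; gcongr; norm_num

lemma Source.hasGrad_integral (h : Source p F K s t) (hp : 1 ≤ p) (hp2 : p ≤ 2)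
    (hb : expB N p < 1) (hK : 0 ≤ K) (hs : 0 ≤ s) (hst : s ≤ t) (ht0 : 0 < t) (ht : t ≤ 1) :
    HasGrad (∫ τ in s..t, heat (t - τ) (F τ)) ∧
    Real.sqrt t * ‖grad (∫ τ in s..t, heat (t - τ) (F τ))‖
      ≤ duhC N p * K * (t - s) ^ (1 - expB N p) := by
  have hC := smoothC_pos N
  have hb1 := sub_pos.2 hb
  have hts := sub_nonneg.2 hst
  have hst0 : 0 < Real.sqrt t := Real.sqrt_pos.2 ht0
  have hk := (intervalIntegrable_ker hb s t).const_mul ((Real.sqrt t)⁻¹ * (4 * smoothC N * K))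
  have hg : ∀ᵐ τ ∂(volume.restrict (Ioc s t)), HasGrad (heat (t - τ) (F τ)) := by
    filter_upwards [ae_Ioc_lt s t] with τ hτ
    exact (hasGrad_heat (by linarith) _).1
  have h1 : ∀ᵐ τ ∂(volume.restrict (Ioc s t)), ‖grad (heat (t - τ) (F τ))‖
      ≤ (Real.sqrt t)⁻¹ * (4 * smoothC N * K) * ker (expB N p) t τ := by
    filter_upwards [ae_Ioc_lt s t, h.bound] with τ hτ hF
    rw [mul_assoc, ← div_eq_inv_mul, le_div_iff₀ hst0, mul_comm]
    exact norm_grad_heat_le_ker hp hp2 hb ht hK (by linarith) hτ.2 hF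
  have hG : Integrable (fun τ => grad (heat (t - τ) (F τ))) (volume.restrict (Ioc s t)) := by
    rw [intervalIntegrable_iff_integrableOn_Ioc_of_le hst] at hk
    exact Integrable.mono' hk (aestronglyMeasurable_grad h.aestronglyMeasurable hg) h1
  have hI := h.intervalIntegrable hp hp2 hb hK hs hst ht
  rw [intervalIntegrable_iff_integrableOn_Ioc_of_le hst] at hI
  have key := isGrad_integral hI hg hG
  rw [← intervalIntegral.integral_of_le hst, ← intervalIntegral.integral_of_le hst] at key
  refine ⟨key.hasGrad, ?_⟩
  rw [key.grad_eq]
  rw [ae_restrict_iff' measurableSet_Ioc] at h1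
  have h3 := intervalIntegral.norm_integral_le_of_norm_le hst h1 hk
  rw [intervalIntegral.integral_const_mul, mul_assoc, ← div_eq_inv_mul, le_div_iff₀ hst0,
    mul_comm] at h3
  refine h3.trans ?_
  have h2 := integral_ker_le (by linarith [half_le_expB (N := N) hp]) hb hs hst
  refine (mul_le_mul_of_nonneg_left h2 (by positivity)).trans_eq ?_
  -- The 8 in `duhC` is the 4 of `norm_grad_heat_le_ker` times the 2 of `integral_ker_le`.
  unfold duhC
  ring

/-- The modulus degenerates only as s → 0: near t₀ > 0 all points exceed t₀/2, and continuity at 0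
is a separate hypothesis. -/
lemma continuousOn_of_sqrt_bound {E : Type*} [NormedAddCommGroup E] {f : ℝ → E} {C θ T : ℝ}
    (hθ : 0 < θ) (hC : 0 ≤ C) (h0 : ContinuousWithinAt f (Icc 0 T) 0)
    (h : ∀ s t, 0 < s → s ≤ t → t ≤ T →
      ‖f t - f s‖ ≤ C * (Real.sqrt (t - s) / Real.sqrt s + (t - s) ^ θ)) :
    ContinuousOn f (Icc 0 T) := by
  intro t₀ ht₀
  rcases ht₀.1.eq_or_lt with rfl | hpos
  · exact h0
  unfold ContinuousWithinAt
  rw [tendsto_iff_norm_sub_tendsto_zero]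
  have hlim : Tendsto (fun x => C * (Real.sqrt |x - t₀| / Real.sqrt (t₀ / 2) + |x - t₀| ^ θ))
      (𝓝[Icc 0 T] t₀) (𝓝 0) := by
    have hc : Continuous fun x => C * (Real.sqrt |x - t₀| / Real.sqrt (t₀ / 2) + |x - t₀| ^ θ) := by
      have : Continuous fun x : ℝ => |x - t₀| ^ θ :=
        Continuous.rpow_const (by fun_prop) fun _ => Or.inr hθ.le
      fun_prop
    have := hc.tendsto t₀
    simp only [sub_self, abs_zero, Real.sqrt_zero, zero_div, zero_add, Real.zero_rpow hθ.ne',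
      mul_zero] at this
    exact this.mono_left nhdsWithin_le_nhds
  refine squeeze_zero' (.of_forall fun _ => norm_nonneg _) ?_ hlim
  have hnear : ∀ᶠ x in 𝓝[Icc 0 T] t₀, t₀ / 2 < x :=
    nhdsWithin_le_nhds (lt_mem_nhds (by linarith))
  have hsq : 0 < Real.sqrt (t₀ / 2) := Real.sqrt_pos.2 (by linarith)
  filter_upwards [hnear, self_mem_nhdsWithin] with x hx hxT
  rcases le_total t₀ x with hle | hle
  · rw [abs_of_nonneg (sub_nonneg.2 hle)]
    refine (h t₀ x hpos hle hxT.2).trans ?_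
    gcongr
    linarith
  · rw [norm_sub_rev, abs_sub_comm, abs_of_nonneg (sub_nonneg.2 hle)]
    refine (h x t₀ (by linarith) hle ht₀.2).trans ?_
    gcongr

lemma continuousOn_heat (u₀ : L2 N) (T : ℝ) : ContinuousOn (fun t => heat t u₀) (Icc 0 T) := by
  refine continuousOn_of_sqrt_bound (C := ‖u₀‖) one_pos (norm_nonneg _) ?_ fun s t hs hst _ => ?_
  · have := tendsto_heat_zero u₀
    unfold ContinuousWithinAt
    beta_reduce
    rw [heat_zero_L2]
    exact this.mono_left (nhdsWithin_mono _ fun x hx => hx.1)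
  · have hts := sub_nonneg.2 hst
    have e : heat t u₀ = heat (t - s) (heat s u₀) := by
      rw [heat_heat_L2 hts hs.le, sub_add_cancel]
    rw [e]
    have hg := hasGrad_heat hs u₀
    refine (norm_heat_sub_le hts hg.1).trans ?_
    calc Real.sqrt (t - s) * ‖grad (heat s u₀)‖
        ≤ Real.sqrt (t - s) * (s ^ (-(1 / 2) : ℝ) * ‖u₀‖) := by
          gcongr
          refine hg.2.trans ?_
          gcongr
          exact norm_heat_L2_le (by linarith) _
      _ = ‖u₀‖ * (Real.sqrt (t - s) / Real.sqrt s) := by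
          rw [Real.rpow_neg hs.le, ← Real.sqrt_eq_rpow]; ring
      _ ≤ _ := by
          gcongr
          exact le_add_of_nonneg_right (by positivity)

/-- By the semigroup law the integral D satisfies D(t) = e^{(t-s)Δ} D(s) + ∫_s^t. The gradient bound
on D(s) controls e^{(t-s)Δ} D(s) - D(s) by √(t-s)/√s, and the new piece is O((t-s)^{1-b}). -/
lemma Source.continuousOn {T : ℝ} (h : Source p F K 0 T) (hp : 1 ≤ p) (hp2 : p ≤ 2)
    (hb : expB N p < 1) (hK : 0 ≤ K) (hT : T ≤ 1) :
    ContinuousOn (fun t => ∫ τ in (0 : ℝ)..t, heat (t - τ) (F τ)) (Icc 0 T) := by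
  have hb1 := sub_pos.2 hb
  have hC := duhC_pos hb
  refine continuousOn_of_sqrt_bound (C := duhC N p * K) hb1 (by positivity) ?_
    fun s t hs hst htT => ?_
  · have e0 : (∫ τ in (0 : ℝ)..0, heat (0 - τ) (F τ) : L2 N) = 0 := intervalIntegral.integral_same
    change Tendsto _ _ (𝓝 (∫ τ in (0 : ℝ)..0, heat (0 - τ) (F τ) : L2 N))
    rw [e0]
    apply tendsto_zero_iff_norm_tendsto_zero.2
    have hlim : Tendsto (fun t : ℝ => duhC N p * K * t ^ (1 - expB N p)) (𝓝[Icc 0 T] 0) (𝓝 0) := by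
      have hc : Continuous fun t : ℝ => duhC N p * K * t ^ (1 - expB N p) :=
        continuous_const.mul (Continuous.rpow_const continuous_id fun _ => Or.inr hb1.le)
      have := hc.tendsto 0
      rw [Real.zero_rpow hb1.ne', mul_zero] at this
      exact this.mono_left nhdsWithin_le_nhds
    refine squeeze_zero' (.of_forall fun _ => norm_nonneg _) ?_ hlim
    filter_upwards [self_mem_nhdsWithin] with t ht
    have := (h.mono le_rfl ht.2).norm_integral_le hp hp2 hb hK le_rfl ht.1 (ht.2.trans hT)
    rwa [sub_zero] at this
  · have hts := sub_nonneg.2 hst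
    have ht0 : 0 < t := hs.trans_le hst
    have hS := h.mono le_rfl (hst.trans htT)
    have hSi := hS.intervalIntegrable hp hp2 hb hK le_rfl hs.le (by linarith)
    have hIt := (h.mono le_rfl htT).intervalIntegrable hp hp2 hb hK le_rfl ht0.le (by linarith)
    have hU := h.mono hs.le htT
    have hG := hS.hasGrad_integral hp hp2 hb hK le_rfl hs.le hs (by linarith)
    have e1 : heat (t - s) (∫ τ in (0 : ℝ)..s, heat (s - τ) (F τ) : L2 N)
        = ∫ τ in (0 : ℝ)..s, heat (t - τ) (F τ) := by
      rw [← heatL_apply _ hts, ← (heatL _ hts).intervalIntegral_comp_comm hSi,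
        intervalIntegral.integral_of_le hs.le, intervalIntegral.integral_of_le hs.le]
      apply integral_congr_ae
      filter_upwards [ae_Ioc_lt 0 s] with τ hτ
      rw [heatL_apply, heat_heat hts (by linarith)]
      congr 1
      ring
    have e2 : ∫ τ in (0 : ℝ)..t, heat (t - τ) (F τ) = (∫ τ in (0 : ℝ)..s, heat (t - τ) (F τ))
        + ∫ τ in s..t, heat (t - τ) (F τ) := by
      rw [intervalIntegral.integral_add_adjacent_intervals]
      · exact hIt.mono_set (by rw [uIcc_of_le hs.le, uIcc_of_le ht0.le]; exact Icc_subset_Icc_right hst)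
      · exact hU.intervalIntegrable hp hp2 hb hK hs.le hst (by linarith)
    rw [e2, ← e1, add_sub_right_comm]
    refine (norm_add_le _ _).trans ?_
    rw [mul_add]
    refine add_le_add ?_ (hU.norm_integral_le hp hp2 hb hK hs.le hst (by linarith))
    refine (norm_heat_sub_le hts hG.1).trans ?_
    have h1 : ‖grad (∫ τ in (0 : ℝ)..s, heat (s - τ) (F τ))‖ ≤ duhC N p * K / Real.sqrt s := by
      rw [le_div_iff₀ (Real.sqrt_pos.2 hs), mul_comm]
      refine hG.2.trans (mul_le_of_le_one_right (by positivity) ?_)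
      rw [sub_zero]
      exact Real.rpow_le_one hs.le (by linarith) hb1.le
    refine (mul_le_mul_of_nonneg_left h1 (Real.sqrt_nonneg _)).trans_eq ?_
    ring

end Duhamel

end

/-! ### Hölder estimates for |u|^p and v·∇u. -/

section

variable {N : ℕ} {p : ℝ}

/-- Bernoulli's inequality at b/a - 1, multiplied by a^p. -/
lemma rpow_sub_rpow_le {a b : ℝ} (hp : 1 ≤ p) (hb : 0 ≤ b) (hab : b ≤ a) :
    a ^ p - b ^ p ≤ p * a ^ (p - 1) * (a - b) := by
  rcases (hb.trans hab).eq_or_lt with h | ha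
  · have : b = 0 := le_antisymm (hab.trans_eq h.symm) hb
    subst this
    rw [← h]; simp
  have h1 := one_add_mul_self_le_rpow_one_add (s := b / a - 1) (by
    have : 0 ≤ b / a := by positivity
    linarith) hp
  rw [add_sub_cancel, Real.div_rpow hb ha.le, le_div_iff₀ (by positivity)] at h1
  have h2 : a ^ p = a ^ (p - 1) * a := by
    rw [← Real.rpow_add_one ha.ne', sub_add_cancel]
  have h3 : (1 + p * (b / a - 1)) * a ^ p = a ^ p - p * a ^ (p - 1) * (a - b) := by
    rw [h2]; field_simp; ring
  linarith

lemma abs_rpow_sub_rpow_le (hp : 1 ≤ p) (a b : ℝ) :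
    |(|a| ^ p - |b| ^ p)| ≤ p * ((|a| + |b|) ^ (p - 1) * |a - b|) := by
  have key : ∀ a b : ℝ, |b| ≤ |a| →
      |(|a| ^ p - |b| ^ p)| ≤ p * ((|a| + |b|) ^ (p - 1) * |a - b|) := fun a b hab => by
    have h0 : |b| ^ p ≤ |a| ^ p := Real.rpow_le_rpow (abs_nonneg _) hab (by linarith)
    rw [abs_of_nonneg (sub_nonneg.2 h0), ← mul_assoc]
    refine (rpow_sub_rpow_le hp (abs_nonneg _) hab).trans ?_
    refine mul_le_mul ?_ (abs_sub_abs_le_abs_sub a b) (sub_nonneg.2 hab) (by positivity)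
    refine mul_le_mul_of_nonneg_left ?_ (by positivity)
    exact Real.rpow_le_rpow (abs_nonneg _) (le_add_of_nonneg_right (abs_nonneg _)) (by linarith)
  rcases le_total |b| |a| with h | h
  · exact key a b h
  · rw [abs_sub_comm, add_comm, abs_sub_comm a b]
    exact key b a h

lemma holderTriple (hp : 1 ≤ p) :
    ENNReal.HolderTriple (2 / ENNReal.ofReal (p - 1)) 2 (2 / ENNReal.ofReal p) := by
  constructor
  have h1 : ENNReal.ofReal p = ENNReal.ofReal (p - 1) + 1 := by
    rw [← ENNReal.ofReal_one, ← ENNReal.ofReal_add (by linarith) zero_le_one, sub_add_cancel]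
  rw [ENNReal.inv_div (by simp) (by simp), ENNReal.inv_div (by simp) (by simp), h1,
    ← one_div, ENNReal.div_add_div_same]

lemma eLpNorm_eq_norm {E : Type*} [NormedAddCommGroup E]
    (f : Lp E 2 (volume : Measure (Torus N))) :
    eLpNorm f 2 volume = ENNReal.ofReal ‖f‖ := by
  rw [Lp.norm_def, ENNReal.ofReal_toReal (Lp.eLpNorm_ne_top f)]

lemma BddLr.mono {f : Torus N → ℝ} {n m : ℝ} (h : BddLr p f n) (hnm : n ≤ m) : BddLr p f m :=
  ⟨h.1, h.2.trans (ENNReal.ofReal_le_ofReal hnm)⟩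

lemma BddLr.congr {f g : Torus N → ℝ} {n : ℝ} (h : BddLr p f n) (hfg : f =ᵐ[volume] g) :
    BddLr p g n :=
  ⟨h.1.congr hfg, (eLpNorm_congr_ae hfg) ▸ h.2⟩

lemma BddLr.sub {f g : Torus N → ℝ} {n m : ℝ} (hp : 1 ≤ p) (hp2 : p ≤ 2) (hn : 0 ≤ n) (hm : 0 ≤ m)
    (hf : BddLr p f n) (hg : BddLr p g m) : BddLr p (fun x => f x - g x) (n + m) := by
  refine ⟨hf.1.sub hg.1, (eLpNorm_sub_le hf.1 hg.1 (one_le_two_div hp hp2)).trans ?_⟩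
  rw [ENNReal.ofReal_add hn hm]
  exact add_le_add hf.2 hg.2

lemma BddLr.integral_abs_le {f : Torus N → ℝ} {n : ℝ} (hp : 1 ≤ p) (hp2 : p ≤ 2) (hn : 0 ≤ n)
    (hf : BddLr p f n) : ∫ x, |f x| ≤ n := by
  have h1 := (eLpNorm_le_eLpNorm_of_exponent_le (one_le_two_div hp hp2) hf.1).trans hf.2
  have h2 := integral_norm_eq_lintegral_enorm hf.1
  rw [← eLpNorm_one_eq_lintegral_enorm] at h2
  simp only [Real.norm_eq_abs] at h2
  rw [h2]
  exact ENNReal.toReal_le_of_le_ofReal hn h1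

/-- The pointwise bound `abs_rpow_sub_rpow_le`, then Hölder with the weight (|u|+|w|)^{p-1} in
L^{2/(p-1)} against u - w in L². -/
lemma powAbs_sub_bddLr (hp : 1 ≤ p) (u w : L2 N) :
    BddLr p (fun x => powAbs p u x - powAbs p w x) (p * (‖u‖ + ‖w‖) ^ (p - 1) * ‖u - w‖) := by
  have hu := Lp.aestronglyMeasurable u
  have hw := Lp.aestronglyMeasurable w
  have hm : ∀ u : L2 N, AEStronglyMeasurable (powAbs p u) volume := fun u => by
    have := (Lp.aestronglyMeasurable u).norm
    exact (Real.continuous_rpow_const (by linarith)).comp_aestronglyMeasurable this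
  refine ⟨(hm u).sub (hm w), ?_⟩
  set g : Torus N → ℝ := fun x => |u x| + |w x| with hg
  have hgm : AEStronglyMeasurable g volume := hu.norm.add hw.norm
  have hg2 : eLpNorm g 2 volume ≤ ENNReal.ofReal (‖u‖ + ‖w‖) := by
    rw [ENNReal.ofReal_add (norm_nonneg _) (norm_nonneg _), ← eLpNorm_eq_norm, ← eLpNorm_eq_norm,
      ← eLpNorm_norm u, ← eLpNorm_norm w]
    exact eLpNorm_add_le hu.norm hw.norm (by norm_num)
  set W : Torus N → ℝ := fun x => ‖g x‖ ^ (p - 1) with hW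
  have hWm : AEStronglyMeasurable W volume :=
    (Real.continuous_rpow_const (by linarith)).comp_aestronglyMeasurable hgm.norm
  have hW2 : eLpNorm W (2 / ENNReal.ofReal (p - 1)) volume
      ≤ ENNReal.ofReal ((‖u‖ + ‖w‖) ^ (p - 1)) := by
    -- For p = 1 the exponent 2/(p-1) is ∞ and the weight is the constant 1.
    rcases hp.eq_or_lt with h1 | h1
    · subst h1
      simp only [hW, sub_self, Real.rpow_zero]
      refine (eLpNorm_le_of_ae_bound (C := 1) (.of_forall fun x => by simp)).trans ?_
      simp
    · have hp1 : 0 < p - 1 := by linarith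
      rw [hW, eLpNorm_norm_rpow _ hp1, ENNReal.div_mul_cancel (by simpa using h1) (by simp),
        ← ENNReal.ofReal_rpow_of_nonneg (by positivity) hp1.le]
      exact ENNReal.rpow_le_rpow hg2 hp1.le
  have hd : AEStronglyMeasurable (u - w : L2 N) volume := Lp.aestronglyMeasurable _
  have := holderTriple hp
  have hH := eLpNorm_le_eLpNorm_mul_eLpNorm_of_nnnorm (r := 2 / ENNReal.ofReal p)
    (p := 2 / ENNReal.ofReal (p - 1)) (q := 2) hWm hd (fun a b => a * b) 1
    (.of_forall fun x => by rw [nnnorm_mul, one_mul])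
  rw [ENNReal.coe_one, one_mul, eLpNorm_eq_norm] at hH
  refine (eLpNorm_le_mul_eLpNorm_of_ae_le_mul (c := p)
    (g := fun x => W x * (u - w : L2 N) x) ?_ _).trans ?_
  · filter_upwards [Lp.coeFn_sub u w] with x hx
    have hWx : W x = (|u x| + |w x|) ^ (p - 1) := by
      simp only [hW, hg]
      rw [Real.norm_of_nonneg (by positivity)]
    rw [hx, Pi.sub_apply, norm_mul, hWx, Real.norm_of_nonneg (by positivity : 0 ≤ (_ : ℝ) ^ (p - 1))]
    exact abs_rpow_sub_rpow_le hp _ _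
  · rw [ENNReal.ofReal_mul (by positivity), ENNReal.ofReal_mul (by positivity), mul_assoc]
    gcongr
    exact hH.trans (by gcongr)

lemma powAbs_zero (hp : 1 ≤ p) : powAbs p (0 : L2 N) =ᵐ[volume] fun _ => 0 := by
  filter_upwards [Lp.coeFn_zero ℝ 2 (volume : Measure (Torus N))] with x hx
  unfold powAbs
  rw [hx, Pi.zero_apply, abs_zero, Real.zero_rpow (by linarith)]

lemma powAbs_bddLr (hp : 1 ≤ p) (u : L2 N) :
    BddLr p (powAbs p u) (p * ‖u‖ ^ (p - 1) * ‖u‖) := by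
  have h := powAbs_sub_bddLr hp u 0
  rw [norm_zero, add_zero, sub_zero] at h
  refine h.congr ?_
  filter_upwards [powAbs_zero (N := N) hp] with x hx
  rw [hx, sub_zero]

lemma inner_bddLr (hp : 1 ≤ p) {A : ℝ} (hA : 0 ≤ A) {w : Torus N → EuclideanSpace ℝ (Fin N)}
    (hw : AEStronglyMeasurable w volume)
    (hwA : eLpNorm w (2 / ENNReal.ofReal (p - 1)) volume ≤ ENNReal.ofReal A) (g : L2Vec N) :
    BddLr p (fun x => inner ℝ (w x) (g x)) (A * ‖g‖) := by
  have hg := Lp.aestronglyMeasurable g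
  refine ⟨hw.inner hg, ?_⟩
  have := holderTriple hp
  have hH := eLpNorm_le_eLpNorm_mul_eLpNorm_of_nnnorm (r := 2 / ENNReal.ofReal p)
    (p := 2 / ENNReal.ofReal (p - 1)) (q := 2) hw hg (fun a b => inner ℝ a b) 1
    (.of_forall fun x => by
      rw [one_mul, ← NNReal.coe_le_coe]
      exact abs_real_inner_le_norm _ _)
  rw [ENNReal.coe_one, one_mul, eLpNorm_eq_norm] at hH
  rw [ENNReal.ofReal_mul hA]
  exact hH.trans (by gcongr)

lemma inner_sub_ae (w : Torus N → EuclideanSpace ℝ (Fin N)) (g h : L2Vec N) :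
    (fun x => inner ℝ (w x) ((g - h : L2Vec N) x)) =ᵐ[volume]
      fun x => inner ℝ (w x) (g x) - inner ℝ (w x) (h x) := by
  filter_upwards [Lp.coeFn_sub g h] with x hx
  rw [hx, Pi.sub_apply, inner_sub_right]

/-- `v` is measurable with `L^∞(L^{2/(p-1)})` norm at most `A`. -/
structure Field (p : ℝ) (v : ℝ → Torus N → EuclideanSpace ℝ (Fin N)) (A : ℝ) : Prop where
  nonneg : 0 ≤ A
  aesm : AEStronglyMeasurable (Function.uncurry v)
    ((volume.restrict (Ioi (0 : ℝ))).prod (volume : Measure (Torus N)))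
  bound : ∀ᵐ τ ∂(volume.restrict (Ioi (0 : ℝ))),
    eLpNorm (v τ) (2 / ENNReal.ofReal (p - 1)) volume ≤ ENNReal.ofReal A

variable {v : ℝ → Torus N → EuclideanSpace ℝ (Fin N)} {A : ℝ} {s t : ℝ}

lemma restrict_Ioc_le (hs : 0 ≤ s) :
    (volume : Measure ℝ).restrict (Ioc s t) ≤ volume.restrict (Ioi 0) :=
  Measure.restrict_mono (fun _ hx => hs.trans_lt hx.1) le_rfl

lemma Field.slice (hv : Field p v A) (hs : 0 ≤ s) : ∀ᵐ τ ∂(volume.restrict (Ioc s t)),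
    AEStronglyMeasurable (v τ) volume ∧
      eLpNorm (v τ) (2 / ENNReal.ofReal (p - 1)) volume ≤ ENNReal.ofReal A := by
  refine ae_mono (restrict_Ioc_le hs) ?_
  filter_upwards [hv.aesm.prodMk_left, hv.bound] with τ h1 h2
  exact ⟨h1, h2⟩

/-- For g independent of time the integrand is jointly measurable, and integrating out x keeps
measurability in τ. -/
lemma Field.aestronglyMeasurable_coeff_const (hv : Field p v A) (hs : 0 ≤ s) (g : L2Vec N)
    (k : Fin N → ℤ) : AEStronglyMeasurable
      (fun τ => coeff (fun x => inner ℝ (v τ x) (g x)) k) (volume.restrict (Ioc s t)) := by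
  have h1 : AEStronglyMeasurable (Function.uncurry v)
      ((volume.restrict (Ioc s t)).prod (volume : Measure (Torus N))) :=
    hv.aesm.mono_measure (Measure.prod_mono (restrict_Ioc_le hs) le_rfl)
  have h2 : AEStronglyMeasurable (fun z : ℝ × Torus N => g z.2)
      ((volume.restrict (Ioc s t)).prod (volume : Measure (Torus N))) :=
    (Lp.aestronglyMeasurable g).comp_snd
  have h3 : AEStronglyMeasurable (fun z : ℝ × Torus N => UnitAddTorus.mFourier (-k) z.2)
      ((volume.restrict (Ioc s t)).prod (volume : Measure (Torus N))) :=
    ((UnitAddTorus.mFourier (-k)).continuous.comp continuous_snd).aestronglyMeasurable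
  have h4 := h3.mul (Complex.continuous_ofReal.comp_aestronglyMeasurable (h1.inner (𝕜 := ℝ) h2))
  exact h4.integral_prod_right'

lemma norm_coeff_inner_sub_le (hp : 1 ≤ p) (hp2 : p ≤ 2) (hA : 0 ≤ A)
    {w : Torus N → EuclideanSpace ℝ (Fin N)} (hw : AEStronglyMeasurable w volume)
    (hwA : eLpNorm w (2 / ENNReal.ofReal (p - 1)) volume ≤ ENNReal.ofReal A) (g h : L2Vec N)
    (k : Fin N → ℤ) :
    ‖coeff (fun x => inner ℝ (w x) (g x)) k - coeff (fun x => inner ℝ (w x) (h x)) k‖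
      ≤ A * ‖g - h‖ := by
  rw [← coeff_sub ((inner_bddLr hp hA hw hwA g).integrable hp hp2)
    ((inner_bddLr hp hA hw hwA h).integrable hp hp2), ← coeff_congr (inner_sub_ae w g h)]
  exact (norm_coeff_le _ _).trans
    ((inner_bddLr hp hA hw hwA (g - h)).integral_abs_le hp hp2 (by positivity))

/-- G is approximated by simple functions of time. On each of their level sets the field is
constant, and the coefficients converge because they are Lipschitz in the field with constant A. -/
lemma Field.aestronglyMeasurable_coeff (hv : Field p v A) (hp : 1 ≤ p) (hp2 : p ≤ 2) (hs : 0 ≤ s)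
    {G : ℝ → L2Vec N} (hG : AEStronglyMeasurable G (volume.restrict (Ioc s t)))
    (k : Fin N → ℤ) : AEStronglyMeasurable
      (fun τ => coeff (fun x => inner ℝ (v τ x) (G τ x)) k) (volume.restrict (Ioc s t)) := by
  have hsm := hG.stronglyMeasurable_mk
  have hA := hv.nonneg
  have h1 : AEStronglyMeasurable
      (fun τ => coeff (fun x => inner ℝ (v τ x) (hG.mk G τ x)) k) (volume.restrict (Ioc s t)) := by
    refine aestronglyMeasurable_of_tendsto_ae atTop
      (f := fun n τ => coeff (fun x => inner ℝ (v τ x) (hsm.approx n τ x)) k) (fun n => ?_) ?_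
    · have e : (fun τ => coeff (fun x => inner ℝ (v τ x) (hsm.approx n τ x)) k)
          = fun τ => ∑ c ∈ (hsm.approx n).range, ((hsm.approx n) ⁻¹' {c}).indicator
            (fun τ => coeff (fun x => inner ℝ (v τ x) (c x)) k) τ := by
        ext τ
        rw [Finset.sum_eq_single (hsm.approx n τ)]
        · rw [indicator_of_mem (by simp)]
        · intro c _ hc
          exact indicator_of_notMem (fun hmem => hc hmem.symm) _
        · intro hmem
          exact absurd (SimpleFunc.mem_range_self _ _) hmem
      rw [e]
      exact Finset.aestronglyMeasurable_fun_sum _ fun c _ =>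
        (hv.aestronglyMeasurable_coeff_const hs c k).indicator
          ((hsm.approx n).measurableSet_preimage _)
    · filter_upwards [hv.slice hs] with τ hτ
      rw [tendsto_iff_norm_sub_tendsto_zero]
      have hlim : Tendsto (fun n => A * ‖hsm.approx n τ - hG.mk G τ‖) atTop (𝓝 0) := by
        have := (tendsto_iff_norm_sub_tendsto_zero.1 (hsm.tendsto_approx τ)).const_mul A
        rwa [mul_zero] at this
      exact squeeze_zero (fun _ => norm_nonneg _)
        (fun n => norm_coeff_inner_sub_le hp hp2 hA hτ.1 hτ.2 _ _ k) hlim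
  refine h1.congr ?_
  filter_upwards [hG.ae_eq_mk] with τ hτ
  rw [hτ]

/-! ### Balls of X_T and the sources they produce. -/

/-- `u` lies in the ball of radius `R` of the solution space on `[0,T]`. -/
structure Ball (T R : ℝ) (u : ℝ → L2 N) : Prop where
  cont : ContinuousOn u (Icc 0 T)
  hasGrad : ∀ t ∈ Ioc 0 T, HasGrad (u t)
  norm_le : ∀ t ∈ Icc 0 T, ‖u t‖ ≤ R
  grad_le : ∀ t ∈ Ioc 0 T, Real.sqrt t * ‖grad (u t)‖ ≤ R

lemma one_le_rpow_neg_half (ht : 0 < t) (ht1 : t ≤ 1) : 1 ≤ t ^ (-(1 / 2) : ℝ) :=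
  Real.one_le_rpow_of_pos_of_le_one_of_nonpos ht ht1 (by norm_num)

lemma le_rpow_of_sqrt_mul_le {x M : ℝ} (ht : 0 < t) (h : Real.sqrt t * x ≤ M) :
    x ≤ M * t ^ (-(1 / 2) : ℝ) := by
  rw [Real.rpow_neg ht.le, ← Real.sqrt_eq_rpow, ← div_eq_mul_inv,
    le_div_iff₀ (Real.sqrt_pos.2 ht), mul_comm]
  exact h

variable {T R : ℝ} {u w : ℝ → L2 N}

lemma Ball.aestronglyMeasurable (hu : Ball T R u) (hs : 0 ≤ s) (ht : t ≤ T) :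
    AEStronglyMeasurable u (volume.restrict (Ioc s t)) :=
  ((hu.cont.mono Ioc_subset_Icc_self).aestronglyMeasurable measurableSet_Ioc).mono_set
    (Ioc_subset_Ioc hs ht)

lemma Ball.aestronglyMeasurable_grad (hu : Ball T R u) (hs : 0 ≤ s) (ht : t ≤ T) :
    AEStronglyMeasurable (fun τ => grad (u τ)) (volume.restrict (Ioc s t)) := by
  refine NonlocalHeat.aestronglyMeasurable_grad (hu.aestronglyMeasurable hs ht) ?_
  filter_upwards [ae_restrict_mem measurableSet_Ioc] with τ hτ
  exact hu.hasGrad τ ⟨hs.trans_lt hτ.1, hτ.2.trans ht⟩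

/-- The Lipschitz constant of `u ↦ |u|^p` on the ball of radius `R`. -/
def lipC (p R : ℝ) : ℝ := p * (R + R) ^ (p - 1)

lemma lipC_nonneg (hp : 1 ≤ p) (hR : 0 ≤ R) : 0 ≤ lipC p R := by unfold lipC; positivity

lemma powAbs_sub_bddLr_of_le (hp : 1 ≤ p) {u w : L2 N} (hu : ‖u‖ ≤ R) (hw : ‖w‖ ≤ R) :
    BddLr p (fun x => powAbs p u x - powAbs p w x) (lipC p R * ‖u - w‖) := by
  refine (powAbs_sub_bddLr hp u w).mono ?_
  unfold lipC
  gcongr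

lemma abs_integral_powAbs_sub_le (hp : 1 ≤ p) (hp2 : p ≤ 2) {u w : L2 N} (hu : ‖u‖ ≤ R)
    (hw : ‖w‖ ≤ R) : |(∫ x, powAbs p u x) - ∫ x, powAbs p w x| ≤ lipC p R * ‖u - w‖ := by
  have hR : 0 ≤ R := (norm_nonneg _).trans hu
  rw [← integral_sub ((powAbs_bddLr hp u).integrable hp hp2)
    ((powAbs_bddLr hp w).integrable hp hp2)]
  have hL := lipC_nonneg hp hR
  exact (abs_integral_le_integral_abs).trans
    ((powAbs_sub_bddLr_of_le hp hu hw).integral_abs_le hp hp2 (by positivity))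

lemma Ball.continuousOn_mean (hu : Ball T R u) (hp : 1 ≤ p) (hp2 : p ≤ 2) :
    ContinuousOn (fun τ => ∫ x, powAbs p (u τ) x) (Icc 0 T) := by
  intro τ hτ
  unfold ContinuousWithinAt
  rw [tendsto_iff_norm_sub_tendsto_zero]
  have h1 := (tendsto_iff_norm_sub_tendsto_zero.1 (hu.cont τ hτ)).const_mul (lipC p R)
  rw [mul_zero] at h1
  refine squeeze_zero' (.of_forall fun _ => norm_nonneg _) ?_ h1
  filter_upwards [self_mem_nhdsWithin] with σ hσ
  exact abs_integral_powAbs_sub_le hp hp2 (hu.norm_le σ hσ) (hu.norm_le τ hτ)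

lemma Ball.continuousOn_coeff (hu : Ball T R u) (hp : 1 ≤ p) (hp2 : p ≤ 2) (k : Fin N → ℤ) :
    ContinuousOn (fun τ => coeff (powAbs p (u τ)) k) (Icc 0 T) := by
  intro τ hτ
  unfold ContinuousWithinAt
  rw [tendsto_iff_norm_sub_tendsto_zero]
  have h1 := (tendsto_iff_norm_sub_tendsto_zero.1 (hu.cont τ hτ)).const_mul (lipC p R)
  rw [mul_zero] at h1
  refine squeeze_zero' (.of_forall fun _ => norm_nonneg _) ?_ h1
  filter_upwards [self_mem_nhdsWithin] with σ hσ
  have hR : 0 ≤ R := (norm_nonneg _).trans (hu.norm_le τ hτ)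
  have hL := lipC_nonneg hp hR
  rw [← coeff_sub ((powAbs_bddLr hp _).integrable hp hp2)
    ((powAbs_bddLr hp _).integrable hp hp2)]
  exact (norm_coeff_le _ _).trans ((powAbs_sub_bddLr_of_le hp (hu.norm_le σ hσ)
    (hu.norm_le τ hτ)).integral_abs_le hp hp2 (by positivity))

lemma Ball.source_powAbs (hu : Ball T R u) (hR : 0 ≤ R) (hp : 1 ≤ p) (hp2 : p ≤ 2) (hT : T ≤ 1) :
    Source p (fun τ => powAbs p (u τ)) (p * R ^ (p - 1) * R) 0 T where
  bound := by
    filter_upwards [ae_restrict_mem measurableSet_Ioc] with τ hτ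
    have hn := hu.norm_le τ (Ioc_subset_Icc_self hτ)
    refine (powAbs_bddLr hp (u τ)).mono ?_
    calc _ ≤ p * R ^ (p - 1) * R := by gcongr
      _ ≤ _ := le_mul_of_one_le_right (by positivity)
        (one_le_rpow_neg_half hτ.1 (hτ.2.trans hT))
  meas k := ((hu.continuousOn_coeff hp hp2 k).mono Ioc_subset_Icc_self).aestronglyMeasurable
    measurableSet_Ioc

lemma Ball.source_advect (hu : Ball T R u) (hv : Field p v A) (hp : 1 ≤ p) (hp2 : p ≤ 2) :
    Source p (fun τ => advect (v τ) (u τ)) (A * R) 0 T where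
  bound := by
    filter_upwards [ae_restrict_mem measurableSet_Ioc, hv.slice le_rfl] with τ hτ hvτ
    refine (inner_bddLr hp hv.nonneg hvτ.1 hvτ.2 (grad (u τ))).mono ?_
    rw [mul_assoc]
    exact mul_le_mul_of_nonneg_left (le_rpow_of_sqrt_mul_le hτ.1 (hu.grad_le τ hτ)) hv.nonneg
  meas k := hv.aestronglyMeasurable_coeff hp hp2 le_rfl
    (hu.aestronglyMeasurable_grad le_rfl le_rfl) k

/-- The difference of the local nonlinearities of two functions. -/
def nlDiff (p : ℝ) (v : ℝ → Torus N → EuclideanSpace ℝ (Fin N)) (u w : ℝ → L2 N) (τ : ℝ) :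
    Torus N → ℝ := fun x => (powAbs p (u τ) x - powAbs p (w τ) x)
      - (advect (v τ) (u τ) x - advect (v τ) (w τ) x)

/-- The advection difference carries τ^{-1/2} from the weighted gradient; the power difference is
bounded and fits under the same weight since τ ≤ 1. -/
lemma Ball.source_nlDiff (hu : Ball T R u) (hw : Ball T R w) (hR : 0 ≤ R) (hv : Field p v A)
    (hp : 1 ≤ p) (hp2 : p ≤ 2) (hT : T ≤ 1) {S : ℝ} (hs : 0 ≤ s) (ht : t ≤ T)
    (hS : ∀ τ ∈ Ioc s t, ‖u τ - w τ‖ ≤ S ∧ Real.sqrt τ * ‖grad (u τ - w τ)‖ ≤ S) :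
    Source p (nlDiff p v u w) ((lipC p R + A) * S) s t := by
  have hL := lipC_nonneg hp hR
  have hA := hv.nonneg
  have hd : ∀ᵐ τ ∂(volume.restrict (Ioc s t)),
      BddLr p (fun x => powAbs p (u τ) x - powAbs p (w τ) x) (lipC p R * ‖u τ - w τ‖) ∧
      BddLr p (fun x => advect (v τ) (u τ) x - advect (v τ) (w τ) x)
        (A * ‖grad (u τ) - grad (w τ)‖) := by
    filter_upwards [ae_restrict_mem measurableSet_Ioc, hv.slice hs] with τ hτ hvτ
    have hτ' : τ ∈ Ioc 0 T := ⟨hs.trans_lt hτ.1, hτ.2.trans ht⟩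
    exact ⟨powAbs_sub_bddLr_of_le hp (hu.norm_le τ (Ioc_subset_Icc_self hτ'))
      (hw.norm_le τ (Ioc_subset_Icc_self hτ')),
      (inner_bddLr hp hA hvτ.1 hvτ.2 _).congr (inner_sub_ae _ _ _)⟩
  constructor
  · filter_upwards [ae_restrict_mem measurableSet_Ioc, hd] with τ hτ hdτ
    have hτ' : τ ∈ Ioc 0 T := ⟨hs.trans_lt hτ.1, hτ.2.trans ht⟩
    have h1 := one_le_rpow_neg_half hτ'.1 (hτ'.2.trans hT)
    obtain ⟨hS1, hS2⟩ := hS τ hτ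
    have hS0 : 0 ≤ S := (norm_nonneg _).trans hS1
    rw [(hu.hasGrad τ hτ').grad_sub (hw.hasGrad τ hτ')] at hS2
    refine (hdτ.1.sub hp hp2 (by positivity) (by positivity) hdτ.2).mono ?_
    rw [add_mul, add_mul]
    refine add_le_add ?_ ?_
    · calc lipC p R * ‖u τ - w τ‖ ≤ lipC p R * S := by gcongr
        _ ≤ _ := le_mul_of_one_le_right (by positivity) h1
    · rw [mul_assoc]
      exact mul_le_mul_of_nonneg_left (le_rpow_of_sqrt_mul_le hτ'.1 hS2) hA
  · intro k
    have m1 := ((hu.source_powAbs hR hp hp2 hT).mono hs ht).meas k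
    have m2 := ((hw.source_powAbs hR hp hp2 hT).mono hs ht).meas k
    have m3 := ((hu.source_advect hv hp hp2).mono hs ht).meas k
    have m4 := ((hw.source_advect hv hp hp2).mono hs ht).meas k
    refine ((m1.sub m2).sub (m3.sub m4)).congr ?_
    filter_upwards [hd, ((hu.source_advect hv hp hp2).mono hs ht).bound,
      ((hw.source_advect hv hp hp2).mono hs ht).bound] with τ hdτ b3 b4
    unfold nlDiff
    rw [coeff_sub (hdτ.1.integrable hp hp2) (hdτ.2.integrable hp hp2),
      coeff_sub ((powAbs_bddLr hp _).integrable hp hp2) ((powAbs_bddLr hp _).integrable hp hp2),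
      coeff_sub (b3.integrable hp hp2) (b4.integrable hp hp2)]
    rfl

end

/-! ### The Duhamel map and its Lipschitz estimate. -/

section

variable {N : ℕ} {p : ℝ} {v : ℝ → Torus N → EuclideanSpace ℝ (Fin N)} {A : ℝ} {s t : ℝ}
  {T R : ℝ} {u w : ℝ → L2 N}

/-- The right-hand side of the mild formulation. -/
def duhamelMap (p : ℝ) (v : ℝ → Torus N → EuclideanSpace ℝ (Fin N)) (u₀ : L2 N) (u : ℝ → L2 N)
    (t : ℝ) : L2 N :=
  heat t u₀ + (∫ τ in (0 : ℝ)..t, heat (t - τ) (powAbs p (u τ)))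
      - (∫ τ in (0 : ℝ)..t, heat (t - τ) (advect (v τ) (u τ)))
      - Lp.const 2 volume (∫ τ in (0 : ℝ)..t, ∫ x, powAbs p (u τ) x)

lemma Ball.intervalIntegrable_powAbs (hu : Ball T R u) (hR : 0 ≤ R) (hp : 1 ≤ p) (hp2 : p ≤ 2)
    (hb : expB N p < 1) (hT : T ≤ 1) (ht : t ∈ Icc 0 T) :
    IntervalIntegrable (fun τ => heat (t - τ) (powAbs p (u τ))) volume 0 t :=
  ((hu.source_powAbs hR hp hp2 hT).mono le_rfl ht.2).intervalIntegrable hp hp2 hb (by positivity)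
    le_rfl ht.1 (ht.2.trans hT)

lemma Ball.intervalIntegrable_advect (hu : Ball T R u) (hR : 0 ≤ R) (hv : Field p v A)
    (hp : 1 ≤ p) (hp2 : p ≤ 2) (hb : expB N p < 1) (hT : T ≤ 1) (ht : t ∈ Icc 0 T) :
    IntervalIntegrable (fun τ => heat (t - τ) (advect (v τ) (u τ))) volume 0 t :=
  ((hu.source_advect hv hp hp2).mono le_rfl ht.2).intervalIntegrable hp hp2 hb
    (mul_nonneg hv.nonneg hR) le_rfl ht.1 (ht.2.trans hT)

lemma Ball.intervalIntegrable_mean (hu : Ball T R u) (hp : 1 ≤ p) (hp2 : p ≤ 2)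
    (ht : t ∈ Icc 0 T) : IntervalIntegrable (fun τ => ∫ x, powAbs p (u τ) x) volume 0 t := by
  refine ContinuousOn.intervalIntegrable ((hu.continuousOn_mean hp hp2).mono ?_)
  rw [uIcc_of_le ht.1]
  exact Icc_subset_Icc_right ht.2

lemma Ball.continuousOn_duhamelMap (hu : Ball T R u) (hR : 0 ≤ R) (hv : Field p v A)
    (hp : 1 ≤ p) (hp2 : p ≤ 2) (hb : expB N p < 1) (hT0 : 0 ≤ T) (hT : T ≤ 1) (u₀ : L2 N) :
    ContinuousOn (duhamelMap p v u₀ u) (Icc 0 T) := by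
  have h1 := (hu.source_powAbs hR hp hp2 hT).continuousOn hp hp2 hb (by positivity) hT
  have h2 := (hu.source_advect hv hp hp2).continuousOn hp hp2 hb (mul_nonneg hv.nonneg hR) hT
  have h3 : ContinuousOn (fun t => ∫ τ in (0 : ℝ)..t, ∫ x, powAbs p (u τ) x) (Icc 0 T) := by
    have := intervalIntegral.continuousOn_primitive_interval
      (μ := volume) (f := fun τ => ∫ x, powAbs p (u τ) x) (a := 0) (b := T) (by
        rw [uIcc_of_le hT0]
        exact (hu.continuousOn_mean hp hp2).integrableOn_Icc)
    rwa [uIcc_of_le hT0] at this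
  have h4 : ContinuousOn (fun t => Lp.const 2 (volume : Measure (Torus N))
      (∫ τ in (0 : ℝ)..t, ∫ x, powAbs p (u τ) x)) (Icc 0 T) :=
    (Lp.constL 2 (volume : Measure (Torus N)) ℝ).continuous.comp_continuousOn h3
  exact (((continuousOn_heat u₀ T).add h1).sub h2).sub h4

lemma Ball.hasGrad_duhamelMap (hu : Ball T R u) (hR : 0 ≤ R) (hv : Field p v A)
    (hp : 1 ≤ p) (hp2 : p ≤ 2) (hb : expB N p < 1) (hT : T ≤ 1) (u₀ : L2 N) (ht : t ∈ Ioc 0 T) :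
    HasGrad (duhamelMap p v u₀ u t) := by
  have h1 := (((hu.source_powAbs hR hp hp2 hT).mono le_rfl ht.2).hasGrad_integral hp hp2 hb
    (by positivity) le_rfl ht.1.le ht.1 (ht.2.trans hT)).1
  have h2 := (((hu.source_advect hv hp hp2).mono le_rfl ht.2).hasGrad_integral hp hp2 hb
    (mul_nonneg hv.nonneg hR) le_rfl ht.1.le ht.1 (ht.2.trans hT)).1
  exact (((hasGrad_heat ht.1 u₀).1.add h1).sub h2).sub (isGrad_const _).hasGrad

lemma heat_zero_fun (t : ℝ) : heat t (fun _ : Torus N => (0 : ℝ)) = 0 := by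
  refine IsHeat.heat_eq (isHeat_iff.2 fun k => ?_)
  rw [← coeffL_apply, map_zero]
  simp [coeff]

lemma norm_const_le (c : ℝ) : ‖Lp.const 2 (volume : Measure (Torus N)) c‖ ≤ |c| :=
  (Lp.norm_const_le 2 volume c).trans_eq (by simp)

/-- The heat flow of u₀ cancels, and so does the history up to s. Existence takes s = 0; uniqueness
takes s at the start of a window. -/
lemma Ball.duhamelMap_sub (hu : Ball T R u) (hw : Ball T R w) (hR : 0 ≤ R) (hv : Field p v A)
    (hp : 1 ≤ p) (hp2 : p ≤ 2) (hb : expB N p < 1) (hT : T ≤ 1) (u₀ : L2 N)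
    (hs : 0 ≤ s) (hst : s ≤ t) (htT : t ≤ T) (heq : ∀ τ ∈ Ioc 0 s, u τ = w τ) :
    duhamelMap p v u₀ u t - duhamelMap p v u₀ w t
      = (∫ τ in s..t, heat (t - τ) (nlDiff p v u w τ)) - Lp.const 2 volume
        (∫ τ in s..t, ((∫ x, powAbs p (u τ) x) - ∫ x, powAbs p (w τ) x)) := by
  have ht : t ∈ Icc 0 T := ⟨hs.trans hst, htT⟩
  have hA := hv.nonneg
  have i1 := hu.intervalIntegrable_powAbs hR hp hp2 hb hT ht
  have i2 := hw.intervalIntegrable_powAbs hR hp hp2 hb hT ht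
  have i3 := hu.intervalIntegrable_advect hR hv hp hp2 hb hT ht
  have i4 := hw.intervalIntegrable_advect hR hv hp hp2 hb hT ht
  have i5 := hu.intervalIntegrable_mean hp hp2 ht
  have i6 := hw.intervalIntegrable_mean hp hp2 ht
  have hb3 := ((hu.source_advect hv hp hp2).mono le_rfl htT).bound
  have hb4 := ((hw.source_advect hv hp hp2).mono le_rfl htT).bound
  have e1 : (∫ τ in (0 : ℝ)..t, heat (t - τ) (nlDiff p v u w τ)) =
      ∫ τ in (0 : ℝ)..t, ((heat (t - τ) (powAbs p (u τ)) - heat (t - τ) (powAbs p (w τ)))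
        - (heat (t - τ) (advect (v τ) (u τ)) - heat (t - τ) (advect (v τ) (w τ)))) := by
    rw [intervalIntegral.integral_of_le ht.1, intervalIntegral.integral_of_le ht.1]
    apply integral_congr_ae
    filter_upwards [ae_Ioc_lt 0 t, hb3, hb4] with τ hτ b3 b4
    have hpos : 0 < t - τ := by linarith
    have p1 := (powAbs_bddLr hp (u τ)).integrable hp hp2
    have p2 := (powAbs_bddLr hp (w τ)).integrable hp hp2
    have p3 := b3.integrable hp hp2
    have p4 := b4.integrable hp hp2
    have p12 : Integrable (fun x => powAbs p (u τ) x - powAbs p (w τ) x) volume := p1.sub p2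
    have p34 : Integrable (fun x => advect (v τ) (u τ) x - advect (v τ) (w τ) x) volume :=
      p3.sub p4
    unfold nlDiff
    rw [heat_sub hpos p12 p34, heat_sub hpos p1 p2, heat_sub hpos p3 p4]
  -- Splitting the integral at s needs integrability on all of (0,t); the crude difference bound 2R
  -- suffices.
  have iD : IntervalIntegrable (fun τ => heat (t - τ) (nlDiff p v u w τ)) volume 0 t := by
    have hS : ∀ τ ∈ Ioc 0 t, ‖u τ - w τ‖ ≤ R + R ∧
        Real.sqrt τ * ‖grad (u τ - w τ)‖ ≤ R + R := fun τ hτ => by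
      have hτ' : τ ∈ Ioc 0 T := ⟨hτ.1, hτ.2.trans htT⟩
      refine ⟨(norm_sub_le _ _).trans (add_le_add (hu.norm_le τ (Ioc_subset_Icc_self hτ'))
        (hw.norm_le τ (Ioc_subset_Icc_self hτ'))), ?_⟩
      rw [(hu.hasGrad τ hτ').grad_sub (hw.hasGrad τ hτ')]
      refine (mul_le_mul_of_nonneg_left (norm_sub_le _ _) (Real.sqrt_nonneg _)).trans ?_
      rw [mul_add]
      exact add_le_add (hu.grad_le τ hτ') (hw.grad_le τ hτ')
    have hL := lipC_nonneg hp hR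
    exact (hu.source_nlDiff hw hR hv hp hp2 hT le_rfl htT hS).intervalIntegrable hp hp2 hb
      (by positivity) le_rfl ht.1 (ht.2.trans hT)
  have hsub1 : uIcc 0 s ⊆ uIcc 0 t := by
    rw [uIcc_of_le hs, uIcc_of_le ht.1]; exact Icc_subset_Icc_right hst
  have hsub2 : uIcc s t ⊆ uIcc 0 t := by
    rw [uIcc_of_le hst, uIcc_of_le ht.1]; exact Icc_subset_Icc_left hs
  have z1 : (∫ τ in (0 : ℝ)..s, heat (t - τ) (nlDiff p v u w τ)) = 0 := by
    rw [intervalIntegral.integral_of_le hs]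
    refine integral_eq_zero_of_ae ?_
    filter_upwards [ae_restrict_mem measurableSet_Ioc] with τ hτ
    have : nlDiff p v u w τ = fun _ => 0 := by
      ext x
      simp [nlDiff, heq τ hτ]
    rw [this, heat_zero_fun]
    rfl
  have z2 : (∫ τ in (0 : ℝ)..s, ((∫ x, powAbs p (u τ) x) - ∫ x, powAbs p (w τ) x)) = 0 := by
    rw [intervalIntegral.integral_of_le hs]
    refine integral_eq_zero_of_ae ?_
    filter_upwards [ae_restrict_mem measurableSet_Ioc] with τ hτ
    rw [heq τ hτ, sub_self]
    rfl
  have e2 := intervalIntegral.integral_add_adjacent_intervals (iD.mono_set hsub1)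
    (iD.mono_set hsub2)
  have e3 := intervalIntegral.integral_add_adjacent_intervals ((i5.sub i6).mono_set hsub1)
    ((i5.sub i6).mono_set hsub2)
  rw [z1, zero_add] at e2
  rw [z2, zero_add] at e3
  rw [e2, e3, e1, intervalIntegral.integral_sub (i1.sub i2) (i3.sub i4),
    intervalIntegral.integral_sub i1 i2, intervalIntegral.integral_sub i3 i4,
    intervalIntegral.integral_sub i5 i6, map_sub]
  unfold duhamelMap
  abel

/-- The Lipschitz constant of the Duhamel map on the ball of radius `R`. -/
def mapC (N : ℕ) (p A R : ℝ) : ℝ := (duhC N p + 1) * (lipC p R + A)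

lemma mapC_nonneg (hb : expB N p < 1) (hp : 1 ≤ p) (hR : 0 ≤ R) (hA : 0 ≤ A) :
    0 ≤ mapC N p A R := by
  have := duhC_pos hb
  have := lipC_nonneg hp hR
  unfold mapC; positivity

/-- The central estimate. A bound S on the difference over (s,t) alone is enough, and the gain
(t-s)^{1-b} depends only on the length of the interval. -/
lemma Ball.norm_duhamelMap_sub_le (hu : Ball T R u) (hw : Ball T R w) (hR : 0 ≤ R)
    (hv : Field p v A) (hp : 1 ≤ p) (hp2 : p ≤ 2) (hb : expB N p < 1) (hT : T ≤ 1) (u₀ : L2 N)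
    (hs : 0 ≤ s) (hst : s ≤ t) (htT : t ≤ T) (heq : ∀ τ ∈ Ioc 0 s, u τ = w τ) {S : ℝ}
    (hS0 : 0 ≤ S)
    (hS : ∀ τ ∈ Ioc s t, ‖u τ - w τ‖ ≤ S ∧ Real.sqrt τ * ‖grad (u τ - w τ)‖ ≤ S) :
    ‖duhamelMap p v u₀ u t - duhamelMap p v u₀ w t‖
        ≤ mapC N p A R * S * (t - s) ^ (1 - expB N p) ∧
    Real.sqrt t * ‖grad (duhamelMap p v u₀ u t - duhamelMap p v u₀ w t)‖
        ≤ mapC N p A R * S * (t - s) ^ (1 - expB N p) := by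
  have hA := hv.nonneg
  have hL := lipC_nonneg hp hR
  have hD := duhC_pos hb
  have hts := sub_nonneg.2 hst
  have ht0 := hs.trans hst
  have ht1 := htT.trans hT
  have hsrc := hu.source_nlDiff hw hR hv hp hp2 hT hs htT hS
  have hK : 0 ≤ (lipC p R + A) * S := by positivity
  have hB1 := hsrc.norm_integral_le hp hp2 hb hK hs hst ht1
  rw [hu.duhamelMap_sub hw hR hv hp hp2 hb hT u₀ hs hst htT heq]
  have hpow : 0 ≤ (t - s) ^ (1 - expB N p) := by positivity
  constructor
  · refine (norm_sub_le _ _).trans ?_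
    have hM : ‖∫ τ in s..t, ((∫ x, powAbs p (u τ) x) - ∫ x, powAbs p (w τ) x)‖
        ≤ lipC p R * S * |t - s| := by
      refine intervalIntegral.norm_integral_le_of_norm_le_const fun τ hτ => ?_
      rw [uIoc_of_le hst] at hτ
      have hτ' : τ ∈ Icc 0 T := ⟨hs.trans hτ.1.le, hτ.2.trans htT⟩
      refine (abs_integral_powAbs_sub_le hp hp2 (hu.norm_le τ hτ') (hw.norm_le τ hτ')).trans ?_
      exact mul_le_mul_of_nonneg_left (hS τ hτ).1 hL
    rw [abs_of_nonneg hts] at hM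
    -- Since t - s ≤ 1, the mean term is absorbed into the same power; it accounts for the +1 in
    -- `mapC`.
    have hle : t - s ≤ (t - s) ^ (1 - expB N p) := by
      rcases hts.eq_or_lt with h | h
      · rw [← h]; positivity
      · have := half_le_expB (N := N) hp
        calc t - s = (t - s) ^ (1 : ℝ) := (Real.rpow_one _).symm
          _ ≤ _ := Real.rpow_le_rpow_of_exponent_ge h (by linarith) (by linarith)
    calc _ ≤ duhC N p * ((lipC p R + A) * S) * (t - s) ^ (1 - expB N p)
          + (lipC p R + A) * S * (t - s) ^ (1 - expB N p) := by
          refine add_le_add hB1 (((norm_const_le _).trans hM).trans ?_)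
          gcongr
          linarith
      _ = _ := by unfold mapC; ring
  · rcases ht0.eq_or_lt with h0 | h0
    · have := mapC_nonneg (N := N) hb hp hR hA
      have hnn : 0 ≤ mapC N p A R * S * (t - s) ^ (1 - expB N p) := by positivity
      rw [← h0] at hnn ⊢
      rwa [Real.sqrt_zero, zero_mul]
    have hB2 := hsrc.hasGrad_integral hp hp2 hb hK hs hst h0 ht1
    rw [hB2.1.grad_sub (isGrad_const _).hasGrad, (isGrad_const _).grad_eq, sub_zero]
    refine hB2.2.trans ?_
    rw [← mul_assoc]
    unfold mapC
    gcongr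
    linarith

lemma isGrad_zero : IsGrad (0 : L2 N) 0 := by
  rw [isGrad_iff]
  intro j k
  rw [map_zero, ← coeffL_apply, map_zero, mul_zero]

lemma ball_zero (hR : 0 ≤ R) : Ball T R (fun _ => (0 : L2 N)) where
  cont := continuousOn_const
  hasGrad _ _ := isGrad_zero.hasGrad
  norm_le _ _ := by rwa [norm_zero]
  grad_le _ _ := by rwa [isGrad_zero.grad_eq, norm_zero, mul_zero]

lemma duhamelMap_zero (hp : 1 ≤ p) (u₀ : L2 N) (t : ℝ) :
    duhamelMap p v u₀ (fun _ => 0) t = heat t u₀ := by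
  have h1 : ∀ τ, heat (t - τ) (powAbs p (0 : L2 N)) = 0 := fun τ => by
    rw [heat_congr (powAbs_zero hp), heat_zero_fun]
  have h2 : ∀ τ, heat (t - τ) (advect (v τ) (0 : L2 N)) = 0 := fun τ => by
    have e : advect (v τ) (0 : L2 N) =ᵐ[volume] fun _ => 0 := by
      unfold advect
      rw [isGrad_zero.grad_eq]
      filter_upwards [Lp.coeFn_zero (EuclideanSpace ℝ (Fin N)) 2 (volume : Measure (Torus N))]
        with x hx
      rw [hx, Pi.zero_apply, inner_zero_right]
    rw [heat_congr e, heat_zero_fun]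
  have h3 : ∫ x, powAbs p (0 : L2 N) x = 0 := by
    rw [integral_congr_ae (powAbs_zero hp), integral_zero]
  unfold duhamelMap
  simp only [h1, h2, h3, intervalIntegral.integral_zero, map_zero, add_zero, sub_zero]

lemma sqrt_mul_norm_grad_heat_le (u₀ : L2 N) (ht : 0 < t) :
    Real.sqrt t * ‖grad (heat t u₀)‖ ≤ ‖u₀‖ := by
  have h := (hasGrad_heat ht u₀).2
  rw [Real.rpow_neg ht.le, ← Real.sqrt_eq_rpow, ← div_eq_inv_mul,
    le_div_iff₀ (Real.sqrt_pos.2 ht), mul_comm] at h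
  exact h.trans (norm_heat_L2_le (by linarith) u₀)

/-! ### Existence by Picard iteration. -/

/-- The Picard iterates. -/
def picard (p : ℝ) (v : ℝ → Torus N → EuclideanSpace ℝ (Fin N)) (u₀ : L2 N) : ℕ → ℝ → L2 N
  | 0 => fun _ => 0
  | n + 1 => duhamelMap p v u₀ (picard p v u₀ n)

section Existence

variable {B : ℝ} {u₀ : L2 N}

lemma mapC_mul_rpow_le (hb : expB N p < 1) (hp : 1 ≤ p) (hR : 0 ≤ R) (hA : 0 ≤ A) {δ : ℝ}
    (hδ : mapC N p A R * δ ^ (1 - expB N p) ≤ 1 / 2) {S : ℝ} (hS : 0 ≤ S) {x : ℝ} (hx0 : 0 ≤ x)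
    (hx : x ≤ δ) : mapC N p A R * S * x ^ (1 - expB N p) ≤ S / 2 := by
  have hC := mapC_nonneg (N := N) hb hp hR hA
  have hb1 := sub_pos.2 hb
  calc mapC N p A R * S * x ^ (1 - expB N p) ≤ mapC N p A R * S * δ ^ (1 - expB N p) := by
        gcongr
    _ = mapC N p A R * δ ^ (1 - expB N p) * S := by ring
    _ ≤ 1 / 2 * S := mul_le_mul_of_nonneg_right hδ hS
    _ = S / 2 := by ring

/-- Comparison with the zero function, whose image is the heat flow of u₀: the flow contributes B,
and the contraction turns the radius 2B into another B. -/
lemma Ball.duhamelMap_mem (hu : Ball T (2 * B) u) (hB : 0 ≤ B) (hu₀ : ‖u₀‖ ≤ B) (hv : Field p v A)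
    (hp : 1 ≤ p) (hp2 : p ≤ 2) (hb : expB N p < 1) (hT0 : 0 ≤ T) (hT : T ≤ 1)
    (hTC : mapC N p A (2 * B) * T ^ (1 - expB N p) ≤ 1 / 2) :
    Ball T (2 * B) (duhamelMap p v u₀ u) := by
  have hR : 0 ≤ 2 * B := by linarith
  have hz : Ball T (2 * B) (fun _ => (0 : L2 N)) := ball_zero hR
  have key : ∀ t ∈ Icc 0 T, ‖duhamelMap p v u₀ u t - heat t u₀‖ ≤ B ∧
      Real.sqrt t * ‖grad (duhamelMap p v u₀ u t - heat t u₀)‖ ≤ B := fun t ht => by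
    have h := hu.norm_duhamelMap_sub_le hz hR hv hp hp2 hb hT u₀ le_rfl ht.1 ht.2
      (fun τ hτ => absurd hτ (by simp)) hR (fun τ hτ => by
        rw [sub_zero]
        exact ⟨hu.norm_le τ ⟨hτ.1.le, hτ.2.trans ht.2⟩, hu.grad_le τ ⟨hτ.1, hτ.2.trans ht.2⟩⟩)
    rw [duhamelMap_zero hp] at h
    have h2 := mapC_mul_rpow_le hb hp hR hv.nonneg hTC hR (x := t - 0) (by linarith [ht.1])
      (by linarith [ht.2])
    constructor <;> linarith [h.1, h.2]
  have hg : ∀ t ∈ Ioc 0 T, HasGrad (duhamelMap p v u₀ u t) := fun t ht =>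
    hu.hasGrad_duhamelMap hR hv hp hp2 hb hT u₀ ht
  refine ⟨hu.continuousOn_duhamelMap hR hv hp hp2 hb hT0 hT u₀, hg, fun t ht => ?_, fun t ht => ?_⟩
  · have h1 := (key t ht).1
    have h2 := norm_heat_L2_le ht.1 u₀
    have h3 := norm_le_norm_add_norm_sub' (duhamelMap p v u₀ u t) (heat t u₀)
    linarith
  · have h1 := (key t (Ioc_subset_Icc_self ht)).2
    have h2 := sqrt_mul_norm_grad_heat_le u₀ ht.1
    rw [(hg t ht).grad_sub (hasGrad_heat ht.1 _).1] at h1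
    have h3 := mul_le_mul_of_nonneg_left (norm_le_norm_add_norm_sub'
      (grad (duhamelMap p v u₀ u t)) (grad (heat t u₀))) (Real.sqrt_nonneg t)
    linarith

lemma ball_picard (hB : 0 ≤ B) (hu₀ : ‖u₀‖ ≤ B) (hv : Field p v A)
    (hp : 1 ≤ p) (hp2 : p ≤ 2) (hb : expB N p < 1) (hT0 : 0 ≤ T) (hT : T ≤ 1)
    (hTC : mapC N p A (2 * B) * T ^ (1 - expB N p) ≤ 1 / 2) (n : ℕ) :
    Ball T (2 * B) (picard p v u₀ n) := by
  induction n with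
  | zero => exact ball_zero (by linarith)
  | succ n ih => exact ih.duhamelMap_mem hB hu₀ hv hp hp2 hb hT0 hT hTC

/-- The first increment is the heat flow, of size B, and each later one is halved. The bound has the
shape C / 2 / 2^n, with C = 2B, of the geometric Cauchy criterion. -/
lemma picard_succ_sub (hB : 0 ≤ B) (hu₀ : ‖u₀‖ ≤ B) (hv : Field p v A)
    (hp : 1 ≤ p) (hp2 : p ≤ 2) (hb : expB N p < 1) (hT0 : 0 ≤ T) (hT : T ≤ 1)
    (hTC : mapC N p A (2 * B) * T ^ (1 - expB N p) ≤ 1 / 2) (n : ℕ) : ∀ t ∈ Icc 0 T,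
    ‖picard p v u₀ (n + 1) t - picard p v u₀ n t‖ ≤ 2 * B / 2 / 2 ^ n ∧
    Real.sqrt t * ‖grad (picard p v u₀ (n + 1) t - picard p v u₀ n t)‖ ≤ 2 * B / 2 / 2 ^ n := by
  have hR : 0 ≤ 2 * B := by linarith
  have hball := ball_picard hB hu₀ hv hp hp2 hb hT0 hT hTC
  induction n with
  | zero =>
    intro t ht
    have e : picard p v u₀ (0 + 1) t - picard p v u₀ 0 t = heat t u₀ := by
      change duhamelMap p v u₀ (fun _ => 0) t - 0 = _
      rw [duhamelMap_zero hp, sub_zero]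
    rw [e, pow_zero, div_one, mul_div_cancel_left₀ _ (two_ne_zero)]
    refine ⟨(norm_heat_L2_le ht.1 _).trans hu₀, ?_⟩
    rcases ht.1.eq_or_lt with h | h
    · rw [← h, Real.sqrt_zero, zero_mul]; exact hB
    · exact (sqrt_mul_norm_grad_heat_le u₀ h).trans hu₀
  | succ n ih =>
    intro t ht
    have h := (hball (n + 1)).norm_duhamelMap_sub_le (hball n) hR hv hp hp2 hb hT u₀ le_rfl
      ht.1 ht.2 (fun τ hτ => absurd hτ (by simp)) (S := 2 * B / 2 / 2 ^ n) (by positivity)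
      (fun τ hτ => ih τ ⟨hτ.1.le, hτ.2.trans ht.2⟩)
    have h2 := mapC_mul_rpow_le hb hp hR hv.nonneg hTC (S := 2 * B / 2 / 2 ^ n) (by positivity)
      (x := t - 0) (by linarith [ht.1]) (by linarith [ht.2])
    rw [pow_succ, ← div_div _ _ (2 : ℝ)]
    exact ⟨h.1.trans h2, h.2.trans h2⟩

/-- The iterates converge uniformly in L² and their gradients converge at each t > 0. Closedness of
the gradient identifies the limit, and the ball bounds pass to it. -/
lemma exists_fixedPoint (hB : 0 ≤ B) (hu₀ : ‖u₀‖ ≤ B) (hv : Field p v A)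
    (hp : 1 ≤ p) (hp2 : p ≤ 2) (hb : expB N p < 1) (hT0 : 0 ≤ T) (hT : T ≤ 1)
    (hTC : mapC N p A (2 * B) * T ^ (1 - expB N p) ≤ 1 / 2) :
    ∃ u : ℝ → L2 N, Ball T (2 * B) u ∧ ∀ t ∈ Icc 0 T, u t = duhamelMap p v u₀ u t := by
  have hR : 0 ≤ 2 * B := by linarith
  have hball := ball_picard hB hu₀ hv hp hp2 hb hT0 hT hTC
  have hdiff := picard_succ_sub hB hu₀ hv hp hp2 hb hT0 hT hTC
  have hd1 : ∀ t ∈ Icc 0 T, ∀ n, dist (picard p v u₀ n t) (picard p v u₀ (n + 1) t)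
      ≤ 2 * B / 2 / 2 ^ n := fun t ht n => by
    rw [dist_comm, dist_eq_norm]; exact (hdiff n t ht).1
  set u : ℝ → L2 N := fun t => limUnder atTop fun n => picard p v u₀ n t with hu
  have hlim : ∀ t ∈ Icc 0 T, Tendsto (fun n => picard p v u₀ n t) atTop (𝓝 (u t)) := fun t ht =>
    (cauchySeq_of_le_geometric_two (hd1 t ht)).tendsto_limUnder
  have hconv : ∀ t ∈ Icc 0 T, ∀ n, ‖picard p v u₀ n t - u t‖ ≤ 2 * B / 2 ^ n := fun t ht n => by
    rw [← dist_eq_norm]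
    exact dist_le_of_le_geometric_two_of_tendsto (hd1 t ht) (hlim t ht) n
  have hgrad : ∀ t ∈ Ioc 0 T, ∃ g : L2Vec N, IsGrad (u t) g ∧
      Tendsto (fun n => grad (picard p v u₀ n t)) atTop (𝓝 g) ∧
      ∀ n, Real.sqrt t * ‖grad (picard p v u₀ n t) - g‖ ≤ 2 * B / 2 ^ n := fun t ht => by
    have hst : 0 < Real.sqrt t := Real.sqrt_pos.2 ht.1
    have hd2 : ∀ n, dist (grad (picard p v u₀ n t)) (grad (picard p v u₀ (n + 1) t))
        ≤ 2 * B / Real.sqrt t / 2 / 2 ^ n := fun n => by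
      have h := (hdiff n t (Ioc_subset_Icc_self ht)).2
      rw [((hball (n + 1)).hasGrad t ht).grad_sub ((hball n).hasGrad t ht)] at h
      rw [dist_comm, dist_eq_norm,
        show 2 * B / Real.sqrt t / 2 / 2 ^ n = 2 * B / 2 / 2 ^ n / Real.sqrt t by ring,
        le_div_iff₀ hst, mul_comm]
      exact h
    obtain ⟨g, hg⟩ := cauchySeq_tendsto_of_complete (cauchySeq_of_le_geometric_two hd2)
    refine ⟨g, isGrad_of_tendsto (hlim t (Ioc_subset_Icc_self ht)) hg
      fun n => ((hball n).hasGrad t ht).isGrad, hg, fun n => ?_⟩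
    have h := dist_le_of_le_geometric_two_of_tendsto hd2 hg n
    rw [dist_eq_norm,
      show 2 * B / Real.sqrt t / 2 ^ n = 2 * B / 2 ^ n / Real.sqrt t by ring,
      le_div_iff₀ hst, mul_comm] at h
    exact h
  have hzero : Tendsto (fun n : ℕ => 2 * B / 2 ^ n) atTop (𝓝 0) :=
    tendsto_const_nhds.div_atTop (tendsto_pow_atTop_atTop_of_one_lt one_lt_two)
  have huB : Ball T (2 * B) u := by
    refine ⟨?_, fun t ht => ?_, fun t ht => ?_, fun t ht => ?_⟩
    · have hU : TendstoUniformlyOn (fun n => picard p v u₀ n) u atTop (Icc 0 T) := by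
        rw [Metric.tendstoUniformlyOn_iff]
        intro ε hε
        filter_upwards [hzero.eventually_lt_const hε] with n hn t ht
        rw [dist_comm, dist_eq_norm]
        exact (hconv t ht n).trans_lt hn
      exact hU.continuousOn (Eventually.of_forall fun n => (hball n).cont).frequently
    · obtain ⟨g, hg, -⟩ := hgrad t ht
      exact hg.hasGrad
    · exact le_of_tendsto (hlim t ht).norm (.of_forall fun n => (hball n).norm_le t ht)
    · obtain ⟨g, hg, hgl, -⟩ := hgrad t ht
      rw [hg.grad_eq]
      exact le_of_tendsto (hgl.norm.const_mul _) (.of_forall fun n => (hball n).grad_le t ht)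
  refine ⟨u, huB, fun t ht => ?_⟩
  -- The Lipschitz estimate between iterate n and u; the shifted iterates then have two limits,
  -- which must agree.
  have h1 : Tendsto (fun n => picard p v u₀ (n + 1) t) atTop (𝓝 (duhamelMap p v u₀ u t)) := by
    rw [tendsto_iff_norm_sub_tendsto_zero]
    refine squeeze_zero (fun _ => norm_nonneg _) (fun n => ?_) hzero
    have hS0 : 0 ≤ 2 * B / 2 ^ n := by positivity
    have h := (hball n).norm_duhamelMap_sub_le huB hR hv hp hp2 hb hT u₀ le_rfl ht.1 ht.2
      (fun τ hτ => absurd hτ (by simp)) (S := 2 * B / 2 ^ n) hS0 (fun τ hτ => by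
        have hτ' : τ ∈ Ioc 0 T := ⟨hτ.1, hτ.2.trans ht.2⟩
        obtain ⟨g, hg, -, hgn⟩ := hgrad τ hτ'
        refine ⟨hconv τ (Ioc_subset_Icc_self hτ') n, ?_⟩
        rw [((hball n).hasGrad τ hτ').grad_sub hg.hasGrad, hg.grad_eq]
        exact hgn n)
    have h2 := mapC_mul_rpow_le hb hp hR hv.nonneg hTC hS0
      (x := t - 0) (by linarith [ht.1]) (by linarith [ht.2])
    exact h.1.trans (h2.trans (by linarith))
  exact tendsto_nhds_unique ((tendsto_add_atTop_iff_nat 1).2 (hlim t ht)) h1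

end Existence

/-! ### Uniqueness in X_T. -/

lemma exists_pos_mapC_mul_rpow_le (hb : expB N p < 1) (hp : 1 ≤ p) (hR : 0 ≤ R) (hA : 0 ≤ A) :
    ∃ δ : ℝ, 0 < δ ∧ δ ≤ 1 ∧ mapC N p A R * δ ^ (1 - expB N p) ≤ 1 / 2 := by
  have hC := mapC_nonneg (N := N) hb hp hR hA
  have hb1 := sub_pos.2 hb
  have hc : ContinuousAt (fun δ : ℝ => mapC N p A R * δ ^ (1 - expB N p)) 0 :=
    (continuous_const.mul (Continuous.rpow_const continuous_id fun _ => Or.inr hb1.le)).continuousAt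
  have h0 : (fun δ : ℝ => mapC N p A R * δ ^ (1 - expB N p)) 0 < 1 / 2 := by
    beta_reduce
    rw [Real.zero_rpow hb1.ne', mul_zero]; norm_num
  have hev := (hc.eventually_lt_const h0).filter_mono (nhdsWithin_le_nhds (s := Ioi 0))
  obtain ⟨δ, h1, h2⟩ := (hev.and (Ioc_mem_nhdsGT one_pos)).exists
  exact ⟨δ, h2.1, h2.2, h1.le⟩

/-- T is not assumed small for this R. A window length δ adapted to R makes the map a contraction on
each [nδ, (n+1)δ], and finitely many windows reach any t. -/
lemma Ball.eqOn_of_fixedPoint {u₀ : L2 N} (hu : Ball T R u) (hw : Ball T R w) (hR : 0 ≤ R)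
    (hv : Field p v A) (hp : 1 ≤ p) (hp2 : p ≤ 2) (hb : expB N p < 1) (hT : T ≤ 1)
    (hfu : ∀ t ∈ Icc 0 T, u t = duhamelMap p v u₀ u t)
    (hfw : ∀ t ∈ Icc 0 T, w t = duhamelMap p v u₀ w t) : EqOn u w (Icc 0 T) := by
  obtain ⟨δ, hδ0, -, hδ⟩ := exists_pos_mapC_mul_rpow_le (N := N) (A := A) hb hp hR hv.nonneg
  have hb1 := sub_pos.2 hb
  have main : ∀ n : ℕ, ∀ t ∈ Icc 0 T, t ≤ n * δ → u t = w t := by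
    intro n
    induction n with
    | zero =>
      intro t ht ht0
      rw [Nat.cast_zero, zero_mul] at ht0
      have : t = 0 := le_antisymm ht0 ht.1
      subst this
      rw [hfu 0 ht, hfw 0 ht]
      simp [duhamelMap]
    | succ n ih =>
      intro t ht htn
      rcases le_total t (n * δ) with hle | hle
      · exact ih t ht hle
      set s : ℝ := n * δ with hs
      have hs0 : 0 ≤ s := by positivity
      have hsub : ∀ τ ∈ Ioc s t, τ ∈ Ioc 0 T := fun τ hτ =>
        ⟨hs0.trans_lt hτ.1, hτ.2.trans ht.2⟩
      have hδt : t - s ≤ δ := by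
        have : ((n + 1 : ℕ) : ℝ) * δ = s + δ := by rw [hs]; push_cast; ring
        linarith
      have heq : ∀ τ ∈ Ioc 0 s, u τ = w τ := fun τ hτ =>
        ih τ ⟨hτ.1.le, hτ.2.trans (hle.trans ht.2)⟩ hτ.2
      -- Feeding the fixed-point equations back into the estimate halves the difference each time.
      -- The gradient bound is carried along because the advection term depends on it.
      have step : ∀ m : ℕ, ∀ τ ∈ Ioc s t, ‖u τ - w τ‖ ≤ (R + R) / 2 ^ m ∧
          Real.sqrt τ * ‖grad (u τ - w τ)‖ ≤ (R + R) / 2 ^ m := by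
        intro m
        induction m with
        | zero =>
          intro τ hτ
          have hτ' := hsub τ hτ
          rw [pow_zero, div_one]
          refine ⟨(norm_sub_le _ _).trans (add_le_add (hu.norm_le τ (Ioc_subset_Icc_self hτ'))
            (hw.norm_le τ (Ioc_subset_Icc_self hτ'))), ?_⟩
          rw [(hu.hasGrad τ hτ').grad_sub (hw.hasGrad τ hτ')]
          refine (mul_le_mul_of_nonneg_left (norm_sub_le _ _) (Real.sqrt_nonneg _)).trans ?_
          rw [mul_add]
          exact add_le_add (hu.grad_le τ hτ') (hw.grad_le τ hτ')
        | succ m ihm =>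
          intro τ hτ
          have hτ' := hsub τ hτ
          have hS0 : 0 ≤ (R + R) / 2 ^ m := by positivity
          have h := hu.norm_duhamelMap_sub_le hw hR hv hp hp2 hb hT u₀ hs0 hτ.1.le hτ'.2 heq hS0
            (fun σ hσ => ihm σ ⟨hσ.1, hσ.2.trans hτ.2⟩)
          rw [← hfu τ (Ioc_subset_Icc_self hτ'), ← hfw τ (Ioc_subset_Icc_self hτ')] at h
          have h2 := mapC_mul_rpow_le hb hp hR hv.nonneg hδ hS0 (x := τ - s)
            (by linarith [hτ.1]) (by linarith [hτ.2])
          rw [pow_succ, ← div_div _ _ (2 : ℝ)]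
          exact ⟨h.1.trans h2, h.2.trans h2⟩
      rcases hle.eq_or_lt with h | h
      · exact ih t ht h.symm.le
      have hzero : Tendsto (fun m : ℕ => (R + R) / 2 ^ m) atTop (𝓝 0) :=
        tendsto_const_nhds.div_atTop (tendsto_pow_atTop_atTop_of_one_lt one_lt_two)
      have := ge_of_tendsto' hzero fun m => (step m t ⟨h, le_rfl⟩).1
      exact sub_eq_zero.1 (norm_le_zero_iff.1 this)
  intro t ht
  obtain ⟨n, hn⟩ := exists_nat_ge (t / δ)
  exact main n t ht ((div_le_iff₀ hδ0).1 hn)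

lemma MemX.exists_ball (hu : MemX T u) : ∃ R, Ball T R u := by
  obtain ⟨h1, h2, M, hM⟩ := hu
  obtain ⟨C, hC⟩ := isCompact_Icc.exists_bound_of_continuousOn h1
  refine ⟨max C M, h1, h2, fun t ht => (hC t ht).trans (le_max_left _ _), fun t ht => ?_⟩
  exact (hM (mem_image_of_mem _ ht)).trans (le_max_right _ _)

lemma Ball.memX (hu : Ball T R u) : MemX T u :=
  ⟨hu.cont, hu.hasGrad, R, by rintro _ ⟨t, ht, rfl⟩; exact hu.grad_le t ht⟩

lemma Ball.mono {R' : ℝ} (hu : Ball T R u) (h : R ≤ R') : Ball T R' u :=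
  ⟨hu.cont, hu.hasGrad, fun t ht => (hu.norm_le t ht).trans h,
    fun t ht => (hu.grad_le t ht).trans h⟩

lemma Ball.isMildSolution {u₀ : L2 N} (hu : Ball T R u) (hR : 0 ≤ R) (hv : Field p v A)
    (hp : 1 ≤ p) (hp2 : p ≤ 2) (hb : expB N p < 1) (hT : T ≤ 1)
    (hfu : ∀ t ∈ Icc 0 T, u t = duhamelMap p v u₀ u t) :
    IsMildSolution p v u₀ T u where
  continuousOn := hu.cont
  hasGrad := hu.hasGrad
  integrable_source _ ht := hu.intervalIntegrable_powAbs hR hp hp2 hb hT ht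
  integrable_advection _ ht := hu.intervalIntegrable_advect hR hv hp hp2 hb hT ht
  integrable_mean _ ht := hu.intervalIntegrable_mean hp hp2 ht
  eq := hfu

lemma field_of_memLinfLq {A : ℝ≥0} (hv : MemLinfLq (2 / ENNReal.ofReal (p - 1)) v)
    (hvA : normLinfLq (2 / ENNReal.ofReal (p - 1)) v ≤ A) : Field p v A where
  nonneg := A.2
  aesm := hv.1
  bound := by
    filter_upwards [ENNReal.ae_le_essSup fun t => eLpNorm (v t) (2 / ENNReal.ofReal (p - 1)) volume]
      with t ht
    rw [ENNReal.ofReal_coe_nnreal]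
    exact ht.trans hvA

end

end NonlocalHeat

end

/-! ### The theorem. -/

theorem mainTheorem3 (N : ℕ) (hN : 1 ≤ N) (p : ℝ) (hp : 1 ≤ p) (hpN : p < 1 + 2 / (N : ℝ))
    (hp1 : N = 1 → p ≤ 2) (A B : ℝ≥0) :
    ∃ T : ℝ, 0 < T ∧ T ≤ 1 ∧
      ∀ (u₀ : NonlocalHeat.L2 N)
        (v : ℝ → NonlocalHeat.Torus N → EuclideanSpace ℝ (Fin N)),
        ‖u₀‖ ≤ B →
        NonlocalHeat.MemLinfLq (2 / ENNReal.ofReal (p - 1)) v →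
        NonlocalHeat.normLinfLq (2 / ENNReal.ofReal (p - 1)) v ≤ A →
        ∃ u : ℝ → NonlocalHeat.L2 N,
          NonlocalHeat.MemX T u ∧ NonlocalHeat.IsMildSolution p v u₀ T u ∧
          ∀ w : ℝ → NonlocalHeat.L2 N,
            NonlocalHeat.MemX T w → NonlocalHeat.IsMildSolution p v u₀ T w →
            EqOn w u (Icc 0 T) := by
  have hN0 : (0 : ℝ) < N := by exact_mod_cast hN
  have hp2 : p ≤ 2 := by
    rcases hN.eq_or_lt with h | h
    · exact hp1 h.symm
    · have h2 : (2 : ℝ) ≤ N := by exact_mod_cast h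
      have : 2 / (N : ℝ) ≤ 1 := (div_le_one hN0).2 h2
      linarith
  have hb : NonlocalHeat.expB N p < 1 := by
    have h1 : p - 1 < 2 / (N : ℝ) := by linarith
    rw [lt_div_iff₀ hN0] at h1
    unfold NonlocalHeat.expB
    linarith
  have hB : (0 : ℝ) ≤ B := B.2
  -- T is fixed by the contraction condition at radius 2B, before u₀ and v are introduced.
  obtain ⟨T, hT0, hT1, hTC⟩ := NonlocalHeat.exists_pos_mapC_mul_rpow_le (N := N) (A := A)
    (R := 2 * B) hb hp (by positivity) A.2
  refine ⟨T, hT0, hT1, fun u₀ v hu₀ hv hvA => ?_⟩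
  have hF := NonlocalHeat.field_of_memLinfLq hv hvA
  obtain ⟨u, hu, hfu⟩ := NonlocalHeat.exists_fixedPoint hB hu₀ hF hp hp2 hb hT0.le hT1 hTC
  refine ⟨u, hu.memX, hu.isMildSolution (by positivity) hF hp hp2 hb hT1 hfu,
    fun w hwX hw => ?_⟩
  -- The radius R of w is arbitrary; both solutions are placed in the ball of radius max R (2B).
  obtain ⟨R, hwR⟩ := hwX.exists_ball
  exact (hwR.mono (le_max_left R (2 * B))).eqOn_of_fixedPoint (hu.mono (le_max_right R (2 * B)))
    (le_max_of_le_right (by positivity)) hF hp hp2 hb hT1 hw.eq hfu
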